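/- **Setting.** $\mathfrak M$ denotes the set of Lebesgue measurable functions $f:[0,\infty)\to\mathbb R$, $\lambda$ is the Lebesgue measure on $[0,\infty)$, and for $f\in\mathfrak M$, $t>0$, $$f^*(t)=\inf\{s>0:\lambda(\{|f|>s\})\le t\}\in[0,\infty],\qquad f^{**}(t)=\frac1t\int_0^t f^*(s)\,ds .$$ A *rearrangement-invariant (r.i.) norm* is a map $\|\cdot\|:\mathfrak M\to[0,\infty]$ such that for all $f,g,f_n\in\mathfrak M$, $c\in\mathbb R$ and measurable $E\subset[0,\infty)$: (P1) $\|f+g\|\le\|f\|+\|g\|$, $\|cf\|=|c|\,\|f\|$ (with $0\cdot\infty=0$), and $\|f\|=0$ iff $f=0$ a.e.; (P2) $0\le g\le f$ a.e. implies $\|g\|\le\|f\|$; (P3) $0\le f_n\uparrow f$ a.e. implies $\|f_n\|\uparrow\|f\|$; (P4) $\lambda(E)<\infty$ implies $\|\chi_E\|<\infty$; (P5) if $\lambda(E)<\infty$, there is $C_E\in(0,\infty)$ with $\int_E f\,d\lambda\le C_E\|f\|$ for all $f\ge0$; (P6) $f^*=g^*$ implies $\|f\|=\|g\|$. The space $\{f\in\mathfrak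 M:\|f\|<\infty\}$ is then called an *r.i. space*. For $p\in[1,\infty)$ it (or its norm) is called *$p$-homogeneous* if $\|f(r\,\cdot)\|=r^{-1/p}\|f\|$ for all $f$ in the space and all $r>0$. For $p\in(1,\infty)$, $q\in(1,\infty)$, the *Lorentz space* is $$L^{p,q}=\Big\{f\in\mathfrak M:\Big(\int_0^\infty f^{**}(t)^q\,t^{\frac qp-1}\,dt\Big)^{1/q}<\infty\Big\}.$$ A *Young function* is a convex, strictly increasing function $\Phi:[0,\infty)\to[0,\infty)$ with $\Phi(0)=0$; put $\Phi(\infty)=\infty$. It satisfies the *$\Delta_2$ condition* if there is $C>0$ with $\Phi(2t)\le C\,\Phi(t)$ for all $t>0$. For $p\in(1,\infty)$ and a Young function $\Phi$, the *Orlicz–Lorentz space* is $L^{p,\Phi}=\{f\in\mathfrak M:\|f\|_{p,\Phi}<\infty\}$, where $$\|f\|_{p,\Phi}=\inf\Big\{c>0:\int_0^\infty\Phi\big(t^{\frac1p}f^{**}(t)/c\big)\frac{dt}t\le1\Big\}\qquad(\inf\emptyset=\infty).$$ **Proposition.** Let $p\in(1,\infty)$. There exist numbers $a,b>0$ such that the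 function $$\Phi(x)=\begin{cases}0,&x=0;\\ x^{\,4+\sin\log(-\log x)},&x\in(0,e^{-1}];\\ ax-b,&x>e^{-1},\end{cases}$$ is a Young function satisfying the $\Delta_2$ condition. Moreover, for this $\Phi$, $\|\cdot\|_{p,\Phi}$ is an r.i. norm that is $p$-homogeneous, i.e. $L^{p,\Phi}$ is a $p$-homogeneous r.i. space, and for every $q\in(3,5)$ $$L^{p,q}\not\subset L^{p,\Phi}\qquad\text{and}\qquad L^{p,\Phi}\not\subset L^{p,q}.$$ -/

import Mathlib

open MeasureTheory Filter Topology
open scoped NNReal ENNReal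

noncomputable section

/-- The Lebesgue measure `λ` on `[0, ∞)`. -/
def lebesgueNN : Measure ℝ≥0 := (volume : Measure ℝ).comap ((↑) : ℝ≥0 → ℝ)

/-- The nonincreasing rearrangement `f*(t) = inf {s > 0 : μ {|f| > s} ≤ t}`, with values in
`[0, ∞]` (the infimum of the empty set is `∞`). -/
def rearr {Ω : Type*} [MeasurableSpace Ω] (μ : Measure Ω) (f : Ω → ℝ) (t : ℝ≥0) : ℝ≥0∞ :=
  ⨅ (s : ℝ≥0) (_ : 0 < s) (_ : μ {x | (s : ℝ) < |f x|} ≤ (t : ℝ≥0∞)), (s : ℝ≥0∞)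

/-- The maximal function `f**(t) = (1/t) ∫₀ᵗ f*(s) ds` of the rearrangement (used for `t > 0`). -/
def maxRearr {Ω : Type*} [MeasurableSpace Ω] (μ : Measure Ω) (f : Ω → ℝ) (t : ℝ≥0) : ℝ≥0∞ :=
  (t : ℝ≥0∞)⁻¹ * ∫⁻ s in Set.Iio t, rearr μ f s ∂lebesgueNN

/-- Rearrangement-invariant norms over `(Ω, μ)`. A functional on the `μ`-measurable real functions
is given as a function on all of `Ω → ℝ`, of which only the values at `μ`-measurable functions
(`AEMeasurable`, that is, measurable for the completion of `μ`) are used. -/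
structure IsRINorm {Ω : Type*} [MeasurableSpace Ω] (μ : Measure Ω) (N : (Ω → ℝ) → ℝ≥0∞) :
    Prop where
  add_le : ∀ f g : Ω → ℝ, AEMeasurable f μ → AEMeasurable g μ → N (f + g) ≤ N f + N g
  smul_eq : ∀ (a : ℝ) (f : Ω → ℝ), AEMeasurable f μ → N (a • f) = ENNReal.ofReal |a| * N f
  eq_zero_iff : ∀ f : Ω → ℝ, AEMeasurable f μ → (N f = 0 ↔ f =ᵐ[μ] 0)
  mono : ∀ f g : Ω → ℝ, AEMeasurable f μ → AEMeasurable g μ →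
    (∀ᵐ x ∂μ, 0 ≤ g x ∧ g x ≤ f x) → N g ≤ N f
  fatou : ∀ (F : ℕ → Ω → ℝ) (f : Ω → ℝ), (∀ n, AEMeasurable (F n) μ) → AEMeasurable f μ →
    (∀ᵐ x ∂μ, (∀ n, 0 ≤ F n x) ∧ Monotone (fun n => F n x) ∧
      Tendsto (fun n => F n x) atTop (𝓝 (f x))) →
    Monotone (fun n => N (F n)) ∧ Tendsto (fun n => N (F n)) atTop (𝓝 (N f))
  indicator_lt_top : ∀ E : Set Ω, NullMeasurableSet E μ → μ E < ∞ →
    N (E.indicator fun _ => (1 : ℝ)) < ∞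
  lintegral_le : ∀ E : Set Ω, NullMeasurableSet E μ → μ E < ∞ →
    ∃ C : ℝ≥0, 0 < C ∧ ∀ f : Ω → ℝ, AEMeasurable f μ → (∀ᵐ x ∂μ, 0 ≤ f x) →
      ∫⁻ x in E, ENNReal.ofReal (f x) ∂μ ≤ (C : ℝ≥0∞) * N f
  rearr_inv : ∀ f g : Ω → ℝ, AEMeasurable f μ → AEMeasurable g μ →
    (∀ t : ℝ≥0, 0 < t → rearr μ f t = rearr μ g t) → N f = N g

/-- The space `{f : N f < ∞}` of measurable functions generated by the functional `N`. -/
def spaceOf {Ω : Type*} [MeasurableSpace Ω] (μ : Measure Ω) (N : (Ω → ℝ) → ℝ≥0∞) :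
    Set (Ω → ℝ) :=
  {f | AEMeasurable f μ ∧ N f < ∞}

/-- The dilation `D_r f(t) = f(rt)` of a function on `[0, ∞)`. -/
def dilation (r : ℝ≥0) (f : ℝ≥0 → ℝ) : ℝ≥0 → ℝ := fun t => f (r * t)

/-- `p`-homogeneity, for finite `p`, of a norm over `[0, ∞)` with the Lebesgue measure:
`‖D_r f‖ = r ^ (-1/p) ‖f‖` for all `f` in the space generated by the norm and all `r > 0`. -/
def IsPHomogeneous (p : ℝ) (N : (ℝ≥0 → ℝ) → ℝ≥0∞) : Prop :=
  ∀ f ∈ spaceOf lebesgueNN N, ∀ r : ℝ≥0, 0 < r →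
    N (dilation r f) = (r : ℝ≥0∞) ^ (-(1 / p)) * N f

/-- The Lorentz norm `‖f‖_(p,q) = (∫₀^∞ f**(t)^q t^(q/p - 1) dt)^(1/q)` for finite `q`. -/
def lorentzNorm (p q : ℝ) (f : ℝ≥0 → ℝ) : ℝ≥0∞ :=
  (∫⁻ t : ℝ≥0, maxRearr lebesgueNN f t ^ q * (t : ℝ≥0∞) ^ (q / p - 1) ∂lebesgueNN) ^ (1 / q)

/-- The Lorentz space `L^{p,q}` over `[0, ∞)`. -/
def lorentzSpace (p q : ℝ) : Set (ℝ≥0 → ℝ) := spaceOf lebesgueNN (lorentzNorm p q)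

/-- Young functions `Φ : [0, ∞) → [0, ∞)`: convex, strictly increasing, `Φ 0 = 0`. Such a function
is given as a function on `ℝ` of which only the values on `[0, ∞)` are used; they are nonnegative
by the last two conditions. -/
structure IsYoung (Φ : ℝ → ℝ) : Prop where
  convexOn : ConvexOn ℝ (Set.Ici 0) Φ
  strictMonoOn : StrictMonoOn Φ (Set.Ici 0)
  map_zero : Φ 0 = 0

/-- The `Δ₂` condition. -/
def SatisfiesDelta2 (Φ : ℝ → ℝ) : Prop :=
  ∃ C : ℝ, 0 < C ∧ ∀ t : ℝ, 0 < t → Φ (2 * t) ≤ C * Φ t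

/-- A Young function as a map `[0, ∞] → [0, ∞]`, with the value `∞` at `∞`. -/
def youngExt (Φ : ℝ → ℝ) (y : ℝ≥0∞) : ℝ≥0∞ :=
  if y = ∞ then ∞ else ENNReal.ofReal (Φ y.toReal)

/-- The Orlicz–Lorentz modular `∫₀^∞ Φ(t^(1/p) f**(t)) dt/t`. -/
def olModular (p : ℝ) (Φ : ℝ → ℝ) (f : ℝ≥0 → ℝ) : ℝ≥0∞ :=
  ∫⁻ t : ℝ≥0, youngExt Φ ((t : ℝ≥0∞) ^ (1 / p) * maxRearr lebesgueNN f t) / (t : ℝ≥0∞) ∂lebesgueNN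

/-- The Luxemburg norm `inf {c > 0 : ϱ(f/c) ≤ 1}` of the Orlicz–Lorentz space. -/
def olNorm (p : ℝ) (Φ : ℝ → ℝ) (f : ℝ≥0 → ℝ) : ℝ≥0∞ :=
  ⨅ (c : ℝ≥0) (_ : 0 < c) (_ : olModular p Φ (fun x => f x / (c : ℝ)) ≤ 1), (c : ℝ≥0∞)

/-- The Orlicz–Lorentz space `L^{p,Φ}` over `[0, ∞)`. -/
def olSpace (p : ℝ) (Φ : ℝ → ℝ) : Set (ℝ≥0 → ℝ) := spaceOf lebesgueNN (olNorm p Φ)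

/-- The function equal to `0` at `0`, to `x ^ (4 + sin (log (-log x)))` on `(0, e⁻¹]` and to
`a x - b` on `(e⁻¹, ∞)` (extended by `0` to the negative numbers, which play no role). -/
def oscPhi (a b : ℝ) (x : ℝ) : ℝ :=
  if x ≤ 0 then 0
  else if x ≤ Real.exp (-1) then x ^ (4 + Real.sin (Real.log (-Real.log x)))
  else a * x - b

end

/-!
The proof rests on two facts about an arbitrary Young function `Φ` and `p > 1`.

First, `olNorm p Φ` is always a rearrangement-invariant norm, and it is `p`-homogeneous
(`isRINorm_olNorm`, `isPHomogeneous_olNorm`). By the layer-cake formula,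
`∫₀ᵗ f* = ∫₀^∞ min (λ {|f| > r}, t) dr`; this expression, `rearrPrim`, replaces the rearrangement
throughout. Monotonicity, the Fatou property, scaling and dilations can be read off from it. The
triangle inequality reduces, by convexity of `Φ`, to the subadditivity of `f ↦ ∫₀ᵗ f*`, which
follows from the variational formula `∫₀ᵗ f* = min_c (t c + ∫ (|f| - c)⁺)`, attained at
`c = f*(t)` (`rearrPrim_le`, `rearrPrim_eq_of_rearr_eq`).

Second, the space of `Φ` is contained in the space of `Ψ` only if `Ψ x ≤ D Φ (D x)` for some `D` and
all small `x` (`not_olSpace_subset`). The test functions are the truncated powers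
`ε min (1, x ^ (-1/p))` on `[0, B)`. For them `t ^ (1/p) f**(t)` is comparable with `ε` on `[1, B]`
and decays like a power outside, so that the modular of `Φ` is about `Φ(ε) (log B + O(1))`. If
the inequality fails for all `D`, suitable `ε` and `B` give functions with `Φ`-norm at most `1` and
arbitrarily large `Ψ`-norm, and a geometrically weighted sum of these lies in the first space but
not in the second (`not_spaceOf_subset`).

The Lorentz space `L^{p,q}` is the Orlicz–Lorentz space of `x ^ q` (`lorentzSpace_eq_olSpace`). With
`x = e ^ (-u)` the function `Φ x = exp (-u (4 + sin log u))` equals `x ^ 3` for some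
arbitrarily large `u` and `x ^ 5` for others, so for `3 < q < 5` it is comparable with `x ^ q` in
neither direction, and both inclusions fail. In the variable `u` the derivative of `Φ` is
`exp (u - u (4 + sin log u)) (4 + sin log u + cos log u)`, which decreases for `u ≥ 1`; this gives
convexity on `[0, e⁻¹]`, and `a`, `b` are chosen such that `Φ` is continuously differentiable at
`e⁻¹`. The bound `x Φ'(x) ≤ 6 Φ(x)` yields `Δ₂`.
-/

noncomputable section

/-! ### Lebesgue measure on the half-line -/

theorem NNReal.measurableEmbedding_toReal : MeasurableEmbedding ((↑) : ℝ≥0 → ℝ) :=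
  MeasurableEmbedding.subtype_coe measurableSet_Ici

theorem lebesgueNN_apply (s : Set ℝ≥0) :
    lebesgueNN s = (volume : Measure ℝ) (((↑) : ℝ≥0 → ℝ) '' s) :=
  NNReal.measurableEmbedding_toReal.comap_apply _ _

theorem lebesgueNN_Iio (t : ℝ≥0) : lebesgueNN (Set.Iio t) = t := by
  have : (((↑) : ℝ≥0 → ℝ) '' Set.Iio t) = Set.Ico 0 (t : ℝ) := by
    ext x
    constructor
    · rintro ⟨y, hy, rfl⟩
      exact ⟨y.2, by exact_mod_cast hy⟩
    · rintro ⟨h0, h1⟩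
      exact ⟨⟨x, h0⟩, by exact_mod_cast h1, rfl⟩
  rw [lebesgueNN_apply, this, Real.volume_Ico]
  simp

instance : SigmaFinite lebesgueNN :=
  ⟨⟨{ set := fun n => Set.Iio (n : ℝ≥0)
      set_mem := fun _ => trivial
      finite := fun n => by rw [lebesgueNN_Iio]; exact ENNReal.coe_lt_top
      spanning := Set.iUnion_eq_univ_iff.2 fun t => exists_nat_gt t }⟩⟩

theorem lebesgueNN_univ : lebesgueNN Set.univ = ∞ := by
  refine ENNReal.eq_top_of_forall_nnreal_le fun r => ?_
  rw [← lebesgueNN_Iio r]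
  exact measure_mono (Set.subset_univ _)

theorem lebesgueNN_setOf_coe_lt (y : ℝ≥0∞) : lebesgueNN {r : ℝ≥0 | (r : ℝ≥0∞) < y} = y := by
  induction y with
  | top => simpa using lebesgueNN_univ
  | coe y => simpa [Set.Iio] using lebesgueNN_Iio y

theorem lebesgueNN_Ici_inter_setOf_coe_lt (c : ℝ≥0) (y : ℝ≥0∞) :
    lebesgueNN (Set.Ici c ∩ {r : ℝ≥0 | (r : ℝ≥0∞) < y}) = y - c := by
  have h : Set.Ici c ∩ {r : ℝ≥0 | (r : ℝ≥0∞) < y} = {r : ℝ≥0 | (r : ℝ≥0∞) < y} \ Set.Iio c := by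
    ext r
    simp [and_comm]
  rw [h]
  rcases le_or_gt (c : ℝ≥0∞) y with hc | hc
  · have hsub : Set.Iio c ⊆ {r : ℝ≥0 | (r : ℝ≥0∞) < y} := fun r (hr : r < c) =>
      lt_of_lt_of_le (by exact_mod_cast hr) hc
    rw [measure_sdiff hsub measurableSet_Iio.nullMeasurableSet
      (by rw [lebesgueNN_Iio]; exact ENNReal.coe_ne_top),
      lebesgueNN_setOf_coe_lt, lebesgueNN_Iio]
  · rw [tsub_eq_zero_of_le hc.le]
    convert measure_empty (μ := lebesgueNN)
    ext r
    simp only [Set.mem_sdiff, Set.mem_ofPred_eq, Set.mem_Iio, not_lt, Set.mem_empty_iff_false,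
      iff_false, not_and, not_le]
    intro hr
    exact_mod_cast hr.trans hc

theorem lintegral_lebesgueNN (g : ℝ≥0 → ℝ≥0∞) :
    ∫⁻ t, g t ∂lebesgueNN = ∫⁻ x in Set.Ioi (0 : ℝ), g x.toNNReal := by
  rw [setLIntegral_congr Ioi_ae_eq_Ici]
  have := lintegral_subtype_comap (μ := (volume : Measure ℝ)) (measurableSet_Ici (a := (0 : ℝ)))
    (fun x => g x.toNNReal)
  rw [← this]
  refine lintegral_congr fun t => ?_
  congr 1
  exact (Real.toNNReal_coe (r := t)).symm

theorem ae_pos_lebesgueNN : ∀ᵐ t ∂lebesgueNN, 0 < t := by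
  have : {t : ℝ≥0 | ¬ 0 < t} = {0} := by
    ext t; simp
  rw [ae_iff, this, lebesgueNN_apply]
  simp

theorem lebesgueNN_preimage_mul {c : ℝ≥0} (hc : 0 < c) (s : Set ℝ≥0) :
    lebesgueNN ((fun t => c * t) ⁻¹' s) = (c : ℝ≥0∞)⁻¹ * lebesgueNN s := by
  have h : (((↑) : ℝ≥0 → ℝ) '' ((fun t => c * t) ⁻¹' s)) =
      (fun x : ℝ => (c : ℝ) * x) ⁻¹' (((↑) : ℝ≥0 → ℝ) '' s) := by
    ext x
    constructor
    · rintro ⟨y, hy, rfl⟩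
      exact ⟨c * y, hy, by simp⟩
    · rintro ⟨y, hy, hyx⟩
      refine ⟨c⁻¹ * y, ?_, ?_⟩
      · simpa [hc.ne'] using hy
      · have : (c : ℝ) ≠ 0 := by exact_mod_cast hc.ne'
        simp [hyx, this]
  have hc' : (c : ℝ) ≠ 0 := by exact_mod_cast hc.ne'
  rw [lebesgueNN_apply, lebesgueNN_apply, h, Real.volume_preimage_mul_left hc']
  congr 1
  rw [abs_of_nonneg (by positivity), ENNReal.ofReal_inv_of_pos (by exact_mod_cast hc)]
  simp

/-- Linear change of variables on the half-line; `g` need not be measurable. -/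
theorem lintegral_lebesgueNN_comp_mul {c : ℝ≥0} (hc : 0 < c) (g : ℝ≥0 → ℝ≥0∞) :
    ∫⁻ t, g (c * t) ∂lebesgueNN = (c : ℝ≥0∞)⁻¹ * ∫⁻ t, g t ∂lebesgueNN := by
  have hm : lebesgueNN.map (fun t => c * t) = (c : ℝ≥0∞)⁻¹ • lebesgueNN := by
    ext s hs
    rw [Measure.map_apply (measurable_const_mul c) hs, lebesgueNN_preimage_mul hc]
    simp
  have he : MeasurableEmbedding (fun t : ℝ≥0 => c * t) :=
    (Homeomorph.mulLeft₀ c hc.ne').measurableEmbedding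
  rw [← he.lintegral_map, hm, lintegral_smul_measure, smul_eq_mul]

/-! ### The distribution function and the primitive of the rearrangement -/

/-- The layer-cake formula, with the levels confined to `S`. -/
theorem lintegral_measure_inter_lt {Ω : Type*} [MeasurableSpace Ω] {ν : Measure Ω} [SFinite ν]
    {g : Ω → ℝ≥0∞} (hg : AEMeasurable g ν) (S : Set ℝ≥0) :
    ∫⁻ r in S, ν {x | (r : ℝ≥0∞) < g x} ∂lebesgueNN =
      ∫⁻ x, lebesgueNN (S ∩ {r : ℝ≥0 | (r : ℝ≥0∞) < g x}) ∂ν := by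
  have h1 : ∀ r : ℝ≥0, ν {x | (r : ℝ≥0∞) < g x} = ν {x | (r : ℝ≥0∞) < hg.mk g x} := by
    intro r
    refine measure_congr ?_
    filter_upwards [hg.ae_eq_mk] with x hx
    change ((r : ℝ≥0∞) < g x) = ((r : ℝ≥0∞) < hg.mk g x)
    rw [hx]
  have h2 : ∫⁻ x, lebesgueNN (S ∩ {r : ℝ≥0 | (r : ℝ≥0∞) < g x}) ∂ν =
      ∫⁻ x, lebesgueNN (S ∩ {r : ℝ≥0 | (r : ℝ≥0∞) < hg.mk g x}) ∂ν := by
    refine lintegral_congr_ae ?_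
    filter_upwards [hg.ae_eq_mk] with x hx
    rw [hx]
  rw [h2]
  simp_rw [h1]
  have hm := hg.measurable_mk
  set G := hg.mk g
  have hset : MeasurableSet {z : ℝ≥0 × Ω | (z.1 : ℝ≥0∞) < G z.2} :=
    measurableSet_lt (measurable_coe_nnreal_ennreal.comp measurable_fst) (hm.comp measurable_snd)
  have h3 : ∀ r : ℝ≥0, ν {x | (r : ℝ≥0∞) < G x} =
      ∫⁻ x, {z : ℝ≥0 × Ω | (z.1 : ℝ≥0∞) < G z.2}.indicator 1 (r, x) ∂ν := by
    intro r
    rw [← lintegral_indicator_one (measurableSet_lt measurable_const hm)]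
    rfl
  have h4 : ∀ x, lebesgueNN (S ∩ {r : ℝ≥0 | (r : ℝ≥0∞) < G x}) =
      ∫⁻ r in S, {z : ℝ≥0 × Ω | (z.1 : ℝ≥0∞) < G z.2}.indicator 1 (r, x) ∂lebesgueNN := by
    intro x
    have hx : MeasurableSet {r : ℝ≥0 | (r : ℝ≥0∞) < G x} :=
      measurableSet_lt measurable_coe_nnreal_ennreal measurable_const
    rw [Set.inter_comm, ← Measure.restrict_apply hx, ← lintegral_indicator_one hx]
    rfl
  simp_rw [h3, h4]
  exact lintegral_lintegral_swap
    (f := fun r x => {z : ℝ≥0 × Ω | (z.1 : ℝ≥0∞) < G z.2}.indicator 1 (r, x))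
    (measurable_one.indicator hset).aemeasurable

section

variable {Ω : Type*} [MeasurableSpace Ω] {μ : Measure Ω}

/-- The distribution function `r ↦ μ {|f| > r}`. -/
def distr {Ω : Type*} [MeasurableSpace Ω] (μ : Measure Ω) (f : Ω → ℝ) (r : ℝ≥0) : ℝ≥0∞ :=
  μ {x | (r : ℝ) < |f x|}

theorem coe_lt_enorm_iff (r : ℝ≥0) (a : ℝ) : (r : ℝ≥0∞) < ‖a‖ₑ ↔ (r : ℝ) < |a| := by
  rw [Real.enorm_eq_ofReal_abs, ENNReal.lt_ofReal_iff_toReal_lt ENNReal.coe_ne_top]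
  simp

theorem distr_eq_measure_lt_enorm (f : Ω → ℝ) (r : ℝ≥0) :
    distr μ f r = μ {x | (r : ℝ≥0∞) < ‖f x‖ₑ} := by
  simp only [distr, coe_lt_enorm_iff]

theorem antitone_distr (f : Ω → ℝ) : Antitone (distr μ f) := fun _ _ h =>
  measure_mono fun _ hx => lt_of_le_of_lt (NNReal.coe_le_coe.2 h) hx

theorem distr_mono {f g : Ω → ℝ} (h : ∀ᵐ x ∂μ, |f x| ≤ |g x|) (r : ℝ≥0) :
    distr μ f r ≤ distr μ g r :=
  measure_mono_ae (h.mono fun _ hx hr => lt_of_lt_of_le hr hx)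

/-- The distribution function is continuous from the right. -/
theorem exists_lt_distr_of_lt_distr {f : Ω → ℝ} {r : ℝ≥0} {y : ℝ≥0∞} (h : y < distr μ f r) :
    ∃ s, r < s ∧ y < distr μ f s := by
  have hu : {x | (r : ℝ) < |f x|} =
      ⋃ n : ℕ, {x | ((r + 1 / ((n : ℝ≥0) + 1) : ℝ≥0) : ℝ) < |f x|} := by
    ext x
    simp only [Set.mem_ofPred_eq, Set.mem_iUnion]
    constructor
    · intro hx
      obtain ⟨n, hn⟩ := exists_nat_one_div_lt (sub_pos.2 hx)
      exact ⟨n, by push_cast; linarith⟩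
    · rintro ⟨n, hn⟩
      refine lt_trans ?_ hn
      push_cast
      have : (0 : ℝ) < 1 / ((n : ℝ) + 1) := by positivity
      linarith
  have hd : Monotone fun n : ℕ => {x | ((r + 1 / ((n : ℝ≥0) + 1) : ℝ≥0) : ℝ) < |f x|} := by
    intro m n hmn x (hx : ((r + 1 / ((m : ℝ≥0) + 1) : ℝ≥0) : ℝ) < |f x|)
    refine lt_of_le_of_lt (b := ((r + 1 / ((m : ℝ≥0) + 1) : ℝ≥0) : ℝ)) ?_ hx
    push_cast
    have : (1 : ℝ) / ((n : ℝ) + 1) ≤ 1 / ((m : ℝ) + 1) := by gcongr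
    linarith
  rw [distr, hu, hd.measure_iUnion, lt_iSup_iff] at h
  obtain ⟨n, hn⟩ := h
  exact ⟨r + 1 / ((n : ℝ≥0) + 1), lt_add_of_pos_right _ (by positivity), hn⟩

/-- The rearrangement and the distribution function are generalized inverses of each other. -/
theorem coe_lt_rearr_iff {f : Ω → ℝ} {r t : ℝ≥0} :
    (r : ℝ≥0∞) < rearr μ f t ↔ (t : ℝ≥0∞) < distr μ f r := by
  constructor
  · intro h
    by_contra! hle
    -- The infimum runs over positive levels only, so the level `r = 0` is approached from above.
    refine absurd h (not_lt.2 (le_of_forall_gt fun y hy => ?_))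
    obtain ⟨s, hs, hsy⟩ := ENNReal.lt_iff_exists_nnreal_btwn.1 hy
    have hrs : r < s := by exact_mod_cast hs
    refine lt_of_le_of_lt ?_ hsy
    exact iInf_le_of_le s (iInf_le_of_le (pos_of_gt hrs)
      (iInf_le_of_le ((antitone_distr f hrs.le).trans hle) le_rfl))
  · intro h
    obtain ⟨s, hrs, hs⟩ := exists_lt_distr_of_lt_distr h
    refine lt_of_lt_of_le (by exact_mod_cast hrs : (r : ℝ≥0∞) < s) ?_
    refine le_iInf fun u => le_iInf fun _ => le_iInf fun hu => ?_
    by_contra! hus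
    have hus' : u ≤ s := by exact_mod_cast hus.le
    exact absurd (hs.trans_le (antitone_distr f hus')) (not_lt.2 hu)

theorem antitone_rearr (f : Ω → ℝ) : Antitone (rearr μ f) := fun _ _ h =>
  ENNReal.le_of_forall_nnreal_lt fun _ hr => (coe_lt_rearr_iff.2
    (lt_of_le_of_lt (ENNReal.coe_le_coe.2 h) (coe_lt_rearr_iff.1 hr))).le

/-- The primitive `∫₀ᵗ f*(s) ds` of the rearrangement, written as the integral of the truncated
distribution function (see `setLIntegral_rearr`). -/
def rearrPrim {Ω : Type*} [MeasurableSpace Ω] (μ : Measure Ω) (f : Ω → ℝ) (t : ℝ≥0) : ℝ≥0∞ :=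
  ∫⁻ r, min (distr μ f r) t ∂lebesgueNN

theorem setLIntegral_rearr (f : Ω → ℝ) (t : ℝ≥0) :
    ∫⁻ s in Set.Iio t, rearr μ f s ∂lebesgueNN = rearrPrim μ f t := by
  have h := lintegral_measure_inter_lt (ν := lebesgueNN.restrict (Set.Iio t))
    (antitone_rearr (μ := μ) f).measurable.aemeasurable Set.univ
  simp only [Measure.restrict_univ, Set.univ_inter, lebesgueNN_setOf_coe_lt] at h
  rw [← h, rearrPrim]
  refine lintegral_congr fun r => ?_
  simp only [coe_lt_rearr_iff]
  have : {s : ℝ≥0 | (s : ℝ≥0∞) < distr μ f r} ∩ Set.Iio t =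
      {s : ℝ≥0 | (s : ℝ≥0∞) < min (distr μ f r) t} := by
    ext s; simp
  rw [Measure.restrict_apply (measurableSet_lt measurable_coe_nnreal_ennreal measurable_const),
    this, lebesgueNN_setOf_coe_lt]

theorem maxRearr_eq (f : Ω → ℝ) (t : ℝ≥0) :
    maxRearr μ f t = (t : ℝ≥0∞)⁻¹ * rearrPrim μ f t := by
  rw [maxRearr, setLIntegral_rearr]

theorem measurable_min_distr (f : Ω → ℝ) (t : ℝ≥0) :
    Measurable fun r => min (distr μ f r) (t : ℝ≥0∞) :=
  (antitone_distr f).measurable.min measurable_const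

theorem rearrPrim_le_of_distr_le {Ω' : Type*} [MeasurableSpace Ω'] {ν : Measure Ω'} {f : Ω → ℝ}
    {g : Ω' → ℝ} (h : ∀ r, distr μ f r ≤ distr ν g r) (t : ℝ≥0) :
    rearrPrim μ f t ≤ rearrPrim ν g t :=
  lintegral_mono fun r => min_le_min_right _ (h r)

theorem monotone_rearrPrim (f : Ω → ℝ) : Monotone (rearrPrim μ f) := fun _ _ h =>
  lintegral_mono fun _ => min_le_min_left _ (ENNReal.coe_le_coe.2 h)

theorem setLIntegral_Ici_distr [SFinite μ] {f : Ω → ℝ} (hf : AEMeasurable f μ) (c : ℝ≥0) :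
    ∫⁻ r in Set.Ici c, distr μ f r ∂lebesgueNN = ∫⁻ x, (‖f x‖ₑ - c) ∂μ := by
  simp_rw [distr_eq_measure_lt_enorm]
  rw [lintegral_measure_inter_lt hf.enorm]
  simp_rw [lebesgueNN_Ici_inter_setOf_coe_lt]

theorem rearrPrim_split (f : Ω → ℝ) (t c : ℝ≥0) :
    rearrPrim μ f t = ∫⁻ r in Set.Iio c, min (distr μ f r) t ∂lebesgueNN +
      ∫⁻ r in Set.Ici c, min (distr μ f r) t ∂lebesgueNN := by
  rw [rearrPrim, ← lintegral_add_compl _ (measurableSet_Iio (a := c)), Set.compl_Iio]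

/-- One half of `∫₀ᵗ f* = min_c (t c + ∫ (|f| - c)⁺)`; the subtraction in `[0, ∞]` is truncated, so
it is the positive part. -/
theorem rearrPrim_le [SFinite μ] {f : Ω → ℝ} (hf : AEMeasurable f μ) (t c : ℝ≥0) :
    rearrPrim μ f t ≤ t * c + ∫⁻ x, (‖f x‖ₑ - c) ∂μ := by
  rw [rearrPrim_split f t c, ← setLIntegral_Ici_distr hf]
  gcongr
  · refine (setLIntegral_mono measurable_const fun r _ => min_le_right _ _).trans ?_
    simp [lebesgueNN_Iio]
  · exact min_le_left _ _

/-- The other half of `∫₀ᵗ f* = min_c (t c + ∫ (|f| - c)⁺)`: the minimum is attained at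
`c = f*(t)`. -/
theorem rearrPrim_eq_of_rearr_eq [SFinite μ] {f : Ω → ℝ} (hf : AEMeasurable f μ) {t c : ℝ≥0}
    (hc : rearr μ f t = c) : rearrPrim μ f t = t * c + ∫⁻ x, (‖f x‖ₑ - c) ∂μ := by
  rw [rearrPrim_split f t c, ← setLIntegral_Ici_distr hf]
  congr 1
  · rw [setLIntegral_congr_fun (g := fun _ => (t : ℝ≥0∞)) measurableSet_Iio]
    · simp [lebesgueNN_Iio]
    · intro r hr
      refine min_eq_right (coe_lt_rearr_iff.1 ?_).le
      rw [hc]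
      exact_mod_cast hr
  · refine setLIntegral_congr_fun measurableSet_Ici fun r hr => ?_
    refine min_eq_left (not_lt.1 fun h => ?_)
    have := coe_lt_rearr_iff.2 h
    rw [hc] at this
    exact absurd hr (not_le.2 (by exact_mod_cast this))

theorem rearrPrim_zero_right (f : Ω → ℝ) : rearrPrim μ f 0 = 0 := by
  simp [rearrPrim]

theorem exists_rearr_eq_of_rearrPrim_ne_top {f : Ω → ℝ} {t : ℝ≥0} (ht : 0 < t)
    (h : rearrPrim μ f t ≠ ∞) : ∃ c : ℝ≥0, rearr μ f t = c := by
  by_contra! hne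
  have htop : rearr μ f t = ∞ := by
    by_contra hn
    exact hne _ (ENNReal.coe_toNNReal hn).symm
  refine h ?_
  have : ∀ r, min (distr μ f r) t = (t : ℝ≥0∞) := fun r =>
    min_eq_right (coe_lt_rearr_iff.1 (by rw [htop]; exact ENNReal.coe_lt_top)).le
  simp only [rearrPrim, this, lintegral_const, lebesgueNN_univ]
  exact ENNReal.mul_top (by exact_mod_cast ht.ne')

/-- Subadditivity of `f ↦ ∫₀ᵗ f*`: add the variational formulas for `f` at `f*(t)` and for `g` at
`g*(t)`. -/
theorem rearrPrim_add_le [SFinite μ] {f g : Ω → ℝ} (hf : AEMeasurable f μ)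
    (hg : AEMeasurable g μ) (t : ℝ≥0) :
    rearrPrim μ (f + g) t ≤ rearrPrim μ f t + rearrPrim μ g t := by
  rcases eq_or_lt_of_le (zero_le : 0 ≤ t) with rfl | ht
  · simp [rearrPrim_zero_right]
  by_cases h1 : rearrPrim μ f t = ∞
  · simp [h1]
  by_cases h2 : rearrPrim μ g t = ∞
  · simp [h2]
  obtain ⟨c, hc⟩ := exists_rearr_eq_of_rearrPrim_ne_top ht h1
  obtain ⟨d, hd⟩ := exists_rearr_eq_of_rearrPrim_ne_top ht h2
  rw [rearrPrim_eq_of_rearr_eq hf hc, rearrPrim_eq_of_rearr_eq hg hd]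
  refine (rearrPrim_le (hf.add hg) t (c + d)).trans ?_
  have : ∫⁻ x, (‖(f + g) x‖ₑ - (c + d : ℝ≥0)) ∂μ ≤
      ∫⁻ x, (‖f x‖ₑ - c) ∂μ + ∫⁻ x, (‖g x‖ₑ - d) ∂μ := by
    rw [← lintegral_add_left' (f := fun x => ‖f x‖ₑ - (c : ℝ≥0∞))
      (hf.enorm.sub aemeasurable_const)]
    refine lintegral_mono fun x => ?_
    refine le_trans ?_ add_tsub_add_le_tsub_add_tsub
    rw [ENNReal.coe_add]
    exact tsub_le_tsub_right (enorm_add_le _ _) _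
  refine (add_le_add_right this _).trans (le_of_eq ?_)
  push_cast
  ring

theorem distr_div {c : ℝ≥0} (hc : 0 < c) (f : Ω → ℝ) (r : ℝ≥0) :
    distr μ (fun x => f x / (c : ℝ)) r = distr μ f (c * r) := by
  have hc' : (0 : ℝ) < c := by exact_mod_cast hc
  simp only [distr, abs_div, abs_of_pos hc', lt_div_iff₀ hc', NNReal.coe_mul, mul_comm]

theorem rearrPrim_div {c : ℝ≥0} (hc : 0 < c) (f : Ω → ℝ) (t : ℝ≥0) :
    rearrPrim μ (fun x => f x / (c : ℝ)) t = (c : ℝ≥0∞)⁻¹ * rearrPrim μ f t := by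
  simp only [rearrPrim, distr_div hc]
  exact lintegral_lebesgueNN_comp_mul hc fun r => min (distr μ f r) (t : ℝ≥0∞)

theorem tendsto_distr {F : ℕ → Ω → ℝ} {f : Ω → ℝ} (hF : ∀ n, AEMeasurable (F n) μ)
    (h : ∀ᵐ x ∂μ, (∀ n, 0 ≤ F n x) ∧ Monotone (fun n => F n x) ∧
      Tendsto (fun n => F n x) atTop (𝓝 (f x))) (r : ℝ≥0) :
    Tendsto (fun n => distr μ (F n) r) atTop (𝓝 (distr μ f r)) := by
  have hf : AEMeasurable f μ := aemeasurable_of_tendsto_metrizable_ae _ hF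
    (h.mono fun x hx => hx.2.2)
  have key : ∀ g : Ω → ℝ, AEMeasurable g μ →
      distr μ g r = ∫⁻ x, {y : ℝ | (r : ℝ) < |y|}.indicator 1 (g x) ∂μ := by
    intro g hg
    have hm : MeasurableSet {y : ℝ | (r : ℝ) < |y|} :=
      measurableSet_lt measurable_const measurable_id.abs
    rw [← lintegral_map' (measurable_one.indicator hm).aemeasurable hg,
      lintegral_indicator_one hm, Measure.map_apply_of_aemeasurable hg hm]
    rfl
  have hm : Measurable ({y : ℝ | (r : ℝ) < |y|}.indicator (1 : ℝ → ℝ≥0∞)) :=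
    measurable_one.indicator (measurableSet_lt measurable_const measurable_id.abs)
  rw [key f hf]
  simp_rw [fun n => key (F n) (hF n)]
  refine lintegral_tendsto_of_tendsto_of_monotone (fun n => hm.comp_aemeasurable (hF n)) ?_ ?_
  · filter_upwards [h] with x hx m n hmn
    refine Set.indicator_apply_le' (fun hr => ?_) (fun _ => zero_le)
    have hr' : (r : ℝ) < |F n x| := lt_of_lt_of_le (b := |F m x|) hr
      (abs_le_abs_of_nonneg (hx.1 m) (hx.2.1 hmn))
    exact (Set.indicator_of_mem (show F n x ∈ {y : ℝ | (r : ℝ) < |y|} from hr') 1).ge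
  · filter_upwards [h] with x hx
    refine tendsto_const_nhds.congr' ?_
    by_cases hr : (r : ℝ) < |f x|
    · filter_upwards [hx.2.2.abs.eventually_const_lt hr] with n hn
      rw [Set.indicator_of_mem (show F n x ∈ {y : ℝ | (r : ℝ) < |y|} from hn),
        Set.indicator_of_mem (show f x ∈ {y : ℝ | (r : ℝ) < |y|} from hr)]
      rfl
    · refine .of_forall fun n => ?_
      have hn : ¬ (r : ℝ) < |F n x| := fun hn => hr (lt_of_lt_of_le hn
        (abs_le_abs_of_nonneg (hx.1 n) (hx.2.1.ge_of_tendsto hx.2.2 n)))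
      dsimp only
      rw [Set.indicator_of_notMem (show F n x ∉ {y : ℝ | (r : ℝ) < |y|} from hn),
        Set.indicator_of_notMem (show f x ∉ {y : ℝ | (r : ℝ) < |y|} from hr)]

theorem tendsto_rearrPrim {F : ℕ → Ω → ℝ} {f : Ω → ℝ} (hF : ∀ n, AEMeasurable (F n) μ)
    (h : ∀ᵐ x ∂μ, (∀ n, 0 ≤ F n x) ∧ Monotone (fun n => F n x) ∧
      Tendsto (fun n => F n x) atTop (𝓝 (f x))) (t : ℝ≥0) :
    Tendsto (fun n => rearrPrim μ (F n) t) atTop (𝓝 (rearrPrim μ f t)) := by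
  refine lintegral_tendsto_of_tendsto_of_monotone
    (fun n => (measurable_min_distr (F n) t).aemeasurable) ?_ ?_
  · refine .of_forall fun r m n hmn => min_le_min_right _ (distr_mono ?_ r)
    filter_upwards [h] with x hx
    rw [abs_of_nonneg (hx.1 m), abs_of_nonneg (hx.1 n)]
    exact hx.2.1 hmn
  · exact .of_forall fun r => (tendsto_distr hF h r).min tendsto_const_nhds

end

/-! ### Young functions on `[0, ∞]` -/

namespace IsYoung

variable {Φ : ℝ → ℝ}

theorem nonneg (hΦ : IsYoung Φ) {x : ℝ} (hx : 0 ≤ x) : 0 ≤ Φ x := by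
  rw [← hΦ.map_zero]
  exact hΦ.strictMonoOn.monotoneOn Set.self_mem_Ici hx hx

theorem pos (hΦ : IsYoung Φ) {x : ℝ} (hx : 0 < x) : 0 < Φ x := by
  rw [← hΦ.map_zero]
  exact hΦ.strictMonoOn Set.self_mem_Ici hx.le hx

theorem map_mul_le (hΦ : IsYoung Φ) {θ x : ℝ} (h0 : 0 ≤ θ) (h1 : θ ≤ 1) (hx : 0 ≤ x) :
    Φ (θ * x) ≤ θ * Φ x := by
  have := hΦ.convexOn.2 (Set.self_mem_Ici (a := (0 : ℝ))) hx (sub_nonneg.2 h1) h0 (by ring)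
  simpa [hΦ.map_zero] using this

theorem exists_lt_map (hΦ : IsYoung Φ) (M : ℝ) : ∃ x : ℝ≥0, 0 < x ∧ M < Φ x := by
  have h1 := hΦ.pos one_pos
  refine ⟨max 1 (Real.toNNReal ((M + 1) / Φ 1)), by positivity, ?_⟩
  set x : ℝ≥0 := max 1 (Real.toNNReal ((M + 1) / Φ 1))
  have hx1 : (1 : ℝ) ≤ x := by exact_mod_cast le_max_left _ _
  have hx2 : (M + 1) / Φ 1 ≤ x := (Real.le_coe_toNNReal _).trans
    (by exact_mod_cast le_max_right _ _)
  have h := hΦ.map_mul_le (θ := (x : ℝ)⁻¹) (by positivity) (inv_le_one_of_one_le₀ hx1) x.2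
  have hx0 : (0 : ℝ) < x := by linarith
  change Φ ((x : ℝ)⁻¹ * x) ≤ (x : ℝ)⁻¹ * Φ x at h
  rw [inv_mul_cancel₀ hx0.ne', le_inv_mul_iff₀ hx0] at h
  rw [div_le_iff₀ h1] at hx2
  linarith

theorem continuousOn (hΦ : IsYoung Φ) : ContinuousOn Φ (Set.Ici 0) := by
  intro x hx
  rcases eq_or_lt_of_le (show (0 : ℝ) ≤ x from hx) with rfl | hx
  · rw [ContinuousWithinAt, hΦ.map_zero]
    have hlim : Tendsto (fun x : ℝ => x * Φ 1) (𝓝[Set.Ici 0] 0) (𝓝 0) := by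
      have : ContinuousWithinAt (fun x : ℝ => x * Φ 1) (Set.Ici 0) 0 := by fun_prop
      simpa [ContinuousWithinAt] using this
    refine tendsto_of_tendsto_of_tendsto_of_le_of_le' tendsto_const_nhds hlim ?_ ?_
    · filter_upwards [self_mem_nhdsWithin] with y hy using hΦ.nonneg hy
    · filter_upwards [self_mem_nhdsWithin, mem_nhdsWithin_of_mem_nhds (Iic_mem_nhds one_pos)]
        with y hy hy1
      simpa using hΦ.map_mul_le (θ := y) (x := 1) hy hy1 zero_le_one
  · have := hΦ.convexOn.continuousOn_interior
    rw [interior_Ici] at this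
    exact (this.continuousAt (Ioi_mem_nhds hx)).continuousWithinAt

theorem youngExt_coe (x : ℝ≥0) : youngExt Φ x = ENNReal.ofReal (Φ x) := by
  simp [youngExt]

theorem youngExt_top : youngExt Φ ∞ = ∞ := by
  simp [youngExt]

theorem youngExt_zero (hΦ : IsYoung Φ) : youngExt Φ 0 = 0 := by
  simp [youngExt, hΦ.map_zero]

theorem monotone_youngExt (hΦ : IsYoung Φ) : Monotone (youngExt Φ) := by
  intro x y h
  induction y with
  | top => simp [youngExt_top]
  | coe y =>
    lift x to ℝ≥0 using ne_top_of_le_ne_top ENNReal.coe_ne_top h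
    rw [youngExt_coe, youngExt_coe]
    exact ENNReal.ofReal_le_ofReal
      (hΦ.strictMonoOn.monotoneOn x.2 y.2 (by exact_mod_cast h))

theorem youngExt_mul_le (hΦ : IsYoung Φ) {θ : ℝ≥0∞} (h : θ ≤ 1) (y : ℝ≥0∞) :
    youngExt Φ (θ * y) ≤ θ * youngExt Φ y := by
  lift θ to ℝ≥0 using ne_top_of_le_ne_top ENNReal.one_ne_top h
  induction y with
  | top =>
    rcases eq_or_ne θ 0 with rfl | h0
    · simp [hΦ.youngExt_zero]
    · simp [youngExt_top, h0]
  | coe y =>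
    rw [← ENNReal.coe_mul, youngExt_coe, youngExt_coe, ← ENNReal.ofReal_coe_nnreal (p := θ),
      ← ENNReal.ofReal_mul θ.coe_nonneg]
    refine ENNReal.ofReal_le_ofReal ?_
    push_cast
    exact hΦ.map_mul_le θ.2 (by exact_mod_cast h) y.2

theorem youngExt_convex (hΦ : IsYoung Φ) {θ η : ℝ≥0} (h : θ + η = 1) (x y : ℝ≥0∞) :
    youngExt Φ (θ * x + η * y) ≤ θ * youngExt Φ x + η * youngExt Φ y := by
  rcases eq_or_ne θ 0 with rfl | hθ
  · obtain rfl : η = 1 := by simpa using h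
    simp
  rcases eq_or_ne η 0 with rfl | hη
  · obtain rfl : θ = 1 := by simpa using h
    simp
  induction x with
  | top => simp [youngExt_top, hθ]
  | coe x =>
    induction y with
    | top => simp [youngExt_top, hη]
    | coe y =>
      rw [← ENNReal.coe_mul, ← ENNReal.coe_mul, ← ENNReal.coe_add, youngExt_coe, youngExt_coe,
        youngExt_coe, ← ENNReal.ofReal_coe_nnreal (p := θ), ← ENNReal.ofReal_coe_nnreal (p := η),
        ← ENNReal.ofReal_mul θ.coe_nonneg, ← ENNReal.ofReal_mul η.coe_nonneg,
        ← ENNReal.ofReal_add (mul_nonneg θ.coe_nonneg (hΦ.nonneg x.coe_nonneg))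
          (mul_nonneg η.coe_nonneg (hΦ.nonneg y.coe_nonneg))]
      refine ENNReal.ofReal_le_ofReal ?_
      push_cast
      exact hΦ.convexOn.2 x.2 y.2 θ.2 η.2 (by exact_mod_cast h)

theorem continuous_youngExt (hΦ : IsYoung Φ) : Continuous (youngExt Φ) := by
  refine continuous_iff_continuousAt.2 fun y => ?_
  induction y with
  | top =>
    rw [ContinuousAt, youngExt_top, ENNReal.tendsto_nhds_top_iff_nnreal]
    intro M
    obtain ⟨x, -, hx⟩ := hΦ.exists_lt_map M
    filter_upwards [lt_mem_nhds (ENNReal.coe_lt_top (r := x))] with z hz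
    refine lt_of_lt_of_le ?_ (hΦ.monotone_youngExt hz.le)
    rw [youngExt_coe, ENNReal.lt_ofReal_iff_toReal_lt ENNReal.coe_ne_top]
    exact hx
  | coe y =>
    refine ENNReal.isOpenEmbedding_coe.continuousAt_iff.1 ?_
    have : youngExt Φ ∘ ((↑) : ℝ≥0 → ℝ≥0∞) = fun x : ℝ≥0 => ENNReal.ofReal (Φ x) :=
      funext youngExt_coe
    rw [this]
    exact ENNReal.continuous_ofReal.continuousAt.comp
      (hΦ.continuousOn.comp_continuous NNReal.continuous_coe fun x => x.2).continuousAt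

theorem exists_le_of_youngExt_le (hΦ : IsYoung Φ) (A : ℝ≥0) :
    ∃ M : ℝ≥0, 0 < M ∧ ∀ y, youngExt Φ y ≤ A → y ≤ M := by
  obtain ⟨x, hx0, hx⟩ := hΦ.exists_lt_map A
  refine ⟨x, hx0, fun y hy => ?_⟩
  by_contra! hxy
  refine absurd ((hΦ.monotone_youngExt hxy.le).trans hy) (not_le.2 ?_)
  rw [youngExt_coe, ENNReal.lt_ofReal_iff_toReal_lt ENNReal.coe_ne_top]
  exact hx

end IsYoung

/-! ### The Orlicz–Lorentz modular and norm -/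

/-- The function `t ↦ t ^ (1/p) f**(t)` inside the Orlicz–Lorentz modular. -/
def scaledMaxRearr (p : ℝ) (f : ℝ≥0 → ℝ) (t : ℝ≥0) : ℝ≥0∞ :=
  (t : ℝ≥0∞) ^ (1 / p) * maxRearr lebesgueNN f t

section
variable {p : ℝ} {Φ : ℝ → ℝ} {f g : ℝ≥0 → ℝ}

theorem scaledMaxRearr_eq (p : ℝ) (f : ℝ≥0 → ℝ) (t : ℝ≥0) : scaledMaxRearr p f t =
    (t : ℝ≥0∞) ^ (1 / p) * ((t : ℝ≥0∞)⁻¹ * rearrPrim lebesgueNN f t) := by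
  rw [scaledMaxRearr, maxRearr_eq]

theorem measurable_scaledMaxRearr (p : ℝ) (f : ℝ≥0 → ℝ) : Measurable (scaledMaxRearr p f) := by
  have h : scaledMaxRearr p f = fun t : ℝ≥0 => (t : ℝ≥0∞) ^ (1 / p) *
      ((t : ℝ≥0∞)⁻¹ * rearrPrim lebesgueNN f t) := funext fun t => scaledMaxRearr_eq p f t
  rw [h]
  have := (monotone_rearrPrim (μ := lebesgueNN) f).measurable
  fun_prop

theorem scaledMaxRearr_le_of_distr_le (h : ∀ r, distr lebesgueNN f r ≤ distr lebesgueNN g r)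
    (t : ℝ≥0) : scaledMaxRearr p f t ≤ scaledMaxRearr p g t := by
  rw [scaledMaxRearr_eq, scaledMaxRearr_eq]
  gcongr
  exact rearrPrim_le_of_distr_le h t

theorem scaledMaxRearr_add_le (hf : AEMeasurable f lebesgueNN) (hg : AEMeasurable g lebesgueNN)
    (t : ℝ≥0) :
    scaledMaxRearr p (f + g) t ≤ scaledMaxRearr p f t + scaledMaxRearr p g t := by
  simp only [scaledMaxRearr_eq, ← mul_add]
  gcongr
  exact rearrPrim_add_le hf hg t

theorem scaledMaxRearr_div {c : ℝ≥0} (hc : 0 < c) (f : ℝ≥0 → ℝ) (t : ℝ≥0) :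
    scaledMaxRearr p (fun x => f x / (c : ℝ)) t = (c : ℝ≥0∞)⁻¹ * scaledMaxRearr p f t := by
  simp only [scaledMaxRearr_eq, rearrPrim_div hc]
  ring

theorem olModular_eq (p : ℝ) (Φ : ℝ → ℝ) (f : ℝ≥0 → ℝ) : olModular p Φ f =
    ∫⁻ t : ℝ≥0, youngExt Φ (scaledMaxRearr p f t) / (t : ℝ≥0∞) ∂lebesgueNN := rfl

theorem olModular_div {c : ℝ≥0} (hc : 0 < c) (f : ℝ≥0 → ℝ) :
    olModular p Φ (fun x => f x / (c : ℝ)) = ∫⁻ t : ℝ≥0,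
      youngExt Φ ((c : ℝ≥0∞)⁻¹ * scaledMaxRearr p f t) / (t : ℝ≥0∞) ∂lebesgueNN := by
  simp only [olModular_eq, scaledMaxRearr_div hc]

theorem olModular_le_of_distr_le (hΦ : IsYoung Φ)
    (h : ∀ r, distr lebesgueNN f r ≤ distr lebesgueNN g r) :
    olModular p Φ f ≤ olModular p Φ g :=
  lintegral_mono fun t => ENNReal.div_le_div_right
    (hΦ.monotone_youngExt (scaledMaxRearr_le_of_distr_le h t)) _

theorem olModular_div_anti (hΦ : IsYoung Φ) {c d : ℝ≥0} (hc : 0 < c) (hcd : c ≤ d)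
    (f : ℝ≥0 → ℝ) :
    olModular p Φ (fun x => f x / (d : ℝ)) ≤ olModular p Φ (fun x => f x / (c : ℝ)) := by
  rw [olModular_div hc, olModular_div (hc.trans_le hcd)]
  refine lintegral_mono fun t => ENNReal.div_le_div_right (hΦ.monotone_youngExt ?_) _
  gcongr

theorem olNorm_le {c : ℝ≥0} (hc : 0 < c) (h : olModular p Φ (fun x => f x / (c : ℝ)) ≤ 1) :
    olNorm p Φ f ≤ c :=
  iInf_le_of_le c (iInf_le_of_le hc (iInf_le_of_le h le_rfl))

theorem olModular_le_one_of_olNorm_lt (hΦ : IsYoung Φ) {c : ℝ≥0} (h : olNorm p Φ f < c) :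
    olModular p Φ (fun x => f x / (c : ℝ)) ≤ 1 := by
  simp only [olNorm, iInf_lt_iff] at h
  obtain ⟨d, hd, hmod, hdc⟩ := h
  exact (olModular_div_anti hΦ hd (by exact_mod_cast hdc.le) f).trans hmod

theorem olNorm_le_of_distr_le (hΦ : IsYoung Φ)
    (h : ∀ r, distr lebesgueNN f r ≤ distr lebesgueNN g r) : olNorm p Φ f ≤ olNorm p Φ g := by
  refine le_iInf fun c => le_iInf fun hc => le_iInf fun hmod => olNorm_le hc (le_trans ?_ hmod)
  refine olModular_le_of_distr_le hΦ fun r => ?_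
  rw [distr_div hc, distr_div hc]
  exact h _

theorem olNorm_mono (hΦ : IsYoung Φ) (h : ∀ᵐ x ∂lebesgueNN, |f x| ≤ |g x|) :
    olNorm p Φ f ≤ olNorm p Φ g :=
  olNorm_le_of_distr_le hΦ (distr_mono h)

theorem olNorm_add_le (hΦ : IsYoung Φ) (hf : AEMeasurable f lebesgueNN)
    (hg : AEMeasurable g lebesgueNN) :
    olNorm p Φ (f + g) ≤ olNorm p Φ f + olNorm p Φ g := by
  have key : ∀ c d : ℝ≥0, 0 < c → 0 < d → olModular p Φ (fun x => f x / (c : ℝ)) ≤ 1 →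
      olModular p Φ (fun x => g x / (d : ℝ)) ≤ 1 → olNorm p Φ (f + g) ≤ c + d := by
    intro c d hc hd h1 h2
    have hcd : 0 < c + d := add_pos hc hd
    rw [← ENNReal.coe_add]
    refine olNorm_le hcd ?_
    rw [olModular_div hc] at h1
    rw [olModular_div hd] at h2
    rw [olModular_div hcd]
    have hθ : c / (c + d) + d / (c + d) = 1 := by rw [← add_div, div_self hcd.ne']
    have hcoef : ∀ e : ℝ≥0, 0 < e → ∀ y : ℝ≥0∞,
        ((e / (c + d) : ℝ≥0) : ℝ≥0∞) * ((e : ℝ≥0∞)⁻¹ * y) = ((c + d : ℝ≥0) : ℝ≥0∞)⁻¹ * y := by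
      intro e he y
      rw [← mul_assoc, ← ENNReal.coe_inv he.ne', ← ENNReal.coe_inv hcd.ne', ← ENNReal.coe_mul]
      congr 2
      field_simp
    calc ∫⁻ t : ℝ≥0, youngExt Φ (((c + d : ℝ≥0) : ℝ≥0∞)⁻¹ * scaledMaxRearr p (f + g) t) /
          (t : ℝ≥0∞) ∂lebesgueNN
        ≤ ∫⁻ t : ℝ≥0, (((c / (c + d) : ℝ≥0) : ℝ≥0∞) *
            (youngExt Φ ((c : ℝ≥0∞)⁻¹ * scaledMaxRearr p f t) / (t : ℝ≥0∞)) +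
            ((d / (c + d) : ℝ≥0) : ℝ≥0∞) *
            (youngExt Φ ((d : ℝ≥0∞)⁻¹ * scaledMaxRearr p g t) / (t : ℝ≥0∞))) ∂lebesgueNN := by
          refine lintegral_mono fun t => ?_
          rw [← mul_div_assoc, ← mul_div_assoc, ← ENNReal.add_div]
          refine ENNReal.div_le_div_right (le_trans ?_ (hΦ.youngExt_convex hθ _ _)) _
          refine hΦ.monotone_youngExt ?_
          rw [hcoef c hc, hcoef d hd, ← mul_add]
          gcongr
          exact scaledMaxRearr_add_le hf hg t
      _ = ((c / (c + d) : ℝ≥0) : ℝ≥0∞) * ∫⁻ t : ℝ≥0,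
            (youngExt Φ ((c : ℝ≥0∞)⁻¹ * scaledMaxRearr p f t) / (t : ℝ≥0∞)) ∂lebesgueNN +
            ((d / (c + d) : ℝ≥0) : ℝ≥0∞) * ∫⁻ t : ℝ≥0,
            (youngExt Φ ((d : ℝ≥0∞)⁻¹ * scaledMaxRearr p g t) / (t : ℝ≥0∞)) ∂lebesgueNN := by
          have hm := hΦ.monotone_youngExt.measurable
          have hWf := measurable_scaledMaxRearr p f
          have hWg := measurable_scaledMaxRearr p g
          rw [lintegral_add_left (by fun_prop), lintegral_const_mul _ (by fun_prop),
            lintegral_const_mul _ (by fun_prop)]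
      _ ≤ ((c / (c + d) : ℝ≥0) : ℝ≥0∞) * 1 + ((d / (c + d) : ℝ≥0) : ℝ≥0∞) * 1 := by gcongr
      _ = 1 := by rw [mul_one, mul_one, ← ENNReal.coe_add, hθ, ENNReal.coe_one]
  by_cases h1 : olNorm p Φ f = ∞
  · simp [h1]
  by_cases h2 : olNorm p Φ g = ∞
  · simp [h2]
  lift olNorm p Φ f to ℝ≥0 using h1 with a ha
  lift olNorm p Φ g to ℝ≥0 using h2 with b hb
  refine ENNReal.le_of_forall_pos_le_add fun ε hε _ => ?_
  have hε2 : 0 < ε / 2 := half_pos hε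
  have := key (a + ε / 2) (b + ε / 2) (by positivity) (by positivity)
    (olModular_le_one_of_olNorm_lt hΦ (by
      rw [← ha]; exact_mod_cast lt_add_of_pos_right a hε2))
    (olModular_le_one_of_olNorm_lt hΦ (by
      rw [← hb]; exact_mod_cast lt_add_of_pos_right b hε2))
  refine this.trans (le_of_eq ?_)
  rw [← ENNReal.coe_add, ← ENNReal.coe_add, ← ENNReal.coe_add, ENNReal.coe_inj]
  rw [add_add_add_comm, add_halves]

theorem olNorm_zero (hΦ : IsYoung Φ) : olNorm p Φ 0 = 0 := by
  have hd : ∀ r, distr lebesgueNN (0 : ℝ≥0 → ℝ) r = 0 := by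
    intro r
    simp [distr]
  have hW : ∀ t, scaledMaxRearr p 0 t = 0 := by
    intro t
    simp [scaledMaxRearr_eq, rearrPrim, hd]
  refine nonpos_iff_eq_zero.1 (ENNReal.le_of_forall_pos_le_add fun ε hε _ => ?_)
  rw [zero_add]
  refine olNorm_le hε ?_
  rw [olModular_div hε]
  simp [hW, hΦ.youngExt_zero]

theorem olNorm_smul (hΦ : IsYoung Φ) (a : ℝ) (f : ℝ≥0 → ℝ) :
    olNorm p Φ (a • f) = ENNReal.ofReal |a| * olNorm p Φ f := by
  rcases eq_or_ne a 0 with rfl | ha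
  · simp [olNorm_zero hΦ]
  have key : ∀ (a : ℝ), a ≠ 0 → ∀ f : ℝ≥0 → ℝ,
      olNorm p Φ (a • f) ≤ ENNReal.ofReal |a| * olNorm p Φ f := by
    intro a ha f
    have ha' : ENNReal.ofReal |a| ≠ 0 := by simpa using ha
    rw [← ENNReal.inv_mul_le_iff ha' ENNReal.ofReal_ne_top]
    refine le_iInf fun c => le_iInf fun hc => le_iInf fun hmod => ?_
    rw [ENNReal.inv_mul_le_iff ha' ENNReal.ofReal_ne_top]
    have hk : 0 < ‖a‖₊ := by simpa using ha
    have h2 : ENNReal.ofReal |a| * (c : ℝ≥0∞) = ((‖a‖₊ * c : ℝ≥0) : ℝ≥0∞) := by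
      rw [← Real.enorm_eq_ofReal_abs, enorm_eq_nnnorm, ENNReal.coe_mul]
    rw [h2]
    refine olNorm_le (mul_pos hk hc) (le_trans ?_ hmod)
    refine olModular_le_of_distr_le hΦ fun r => distr_mono (.of_forall fun x => le_of_eq ?_) r
    have hc' : (c : ℝ) ≠ 0 := by exact_mod_cast hc.ne'
    have ha'' : |a| ≠ 0 := abs_ne_zero.2 ha
    simp only [Pi.smul_apply, smul_eq_mul, NNReal.coe_mul, coe_nnnorm, Real.norm_eq_abs, abs_div,
      abs_mul, abs_abs]
    field_simp
  refine le_antisymm (key a ha f) ?_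
  have h := key a⁻¹ (inv_ne_zero ha) (a • f)
  rw [inv_smul_smul₀ ha] at h
  refine (mul_le_mul_right h (ENNReal.ofReal |a|)).trans (le_of_eq ?_)
  rw [← mul_assoc, ← ENNReal.ofReal_mul (abs_nonneg a), ← abs_mul, mul_inv_cancel₀ ha]
  simp

theorem setLIntegral_enorm_le_rearrPrim (hf : AEMeasurable f lebesgueNN) {E : Set ℝ≥0} {T : ℝ≥0}
    (hE : lebesgueNN E ≤ T) : ∫⁻ x in E, ‖f x‖ₑ ∂lebesgueNN ≤ rearrPrim lebesgueNN f T := by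
  have h := lintegral_measure_inter_lt (ν := lebesgueNN.restrict E) hf.enorm.restrict Set.univ
  simp only [Measure.restrict_univ, Set.univ_inter, lebesgueNN_setOf_coe_lt] at h
  rw [← h]
  refine lintegral_mono fun r => le_min ?_ ?_
  · rw [distr_eq_measure_lt_enorm]
    exact Measure.restrict_apply_le _ _
  · exact (measure_mono (Set.subset_univ _)).trans (by simpa using hE)

/-- The Orlicz–Lorentz norm dominates the `L¹` norm on sets of finite measure. -/
theorem exists_setLIntegral_enorm_le_olNorm (hp : 0 < p) (hΦ : IsYoung Φ) {E : Set ℝ≥0}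
    (hE : lebesgueNN E < ∞) : ∃ C : ℝ≥0, 0 < C ∧ ∀ f : ℝ≥0 → ℝ, AEMeasurable f lebesgueNN →
      ∫⁻ x in E, ‖f x‖ₑ ∂lebesgueNN ≤ (C : ℝ≥0∞) * olNorm p Φ f := by
  obtain ⟨M, hM0, hM⟩ := hΦ.exists_le_of_youngExt_le 2
  -- The modular over `[T, 2T]` alone bounds `∫₀ᵀ f*`.
  set T : ℝ≥0 := max 1 (lebesgueNN E).toNNReal
  have hT : 0 < T := by positivity
  have hET : lebesgueNN E ≤ T := by
    rw [← ENNReal.coe_toNNReal hE.ne]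
    exact_mod_cast le_max_right _ _
  set α : ℝ≥0 := T ^ (1 / p) * (2 * T)⁻¹
  have hα : 0 < α := by positivity
  refine ⟨M * α⁻¹, by positivity, fun f hf => ?_⟩
  refine (setLIntegral_enorm_le_rearrPrim hf hET).trans ?_
  set P := rearrPrim lebesgueNN f T
  have hW : ∀ t ∈ Set.Ico T (2 * T), (α : ℝ≥0∞) * P ≤ scaledMaxRearr p f t := by
    intro t ht
    rw [scaledMaxRearr_eq, ENNReal.coe_mul, mul_assoc]
    refine mul_le_mul' ?_ (mul_le_mul' ?_ (monotone_rearrPrim f ht.1))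
    · rw [ENNReal.coe_rpow_of_nonneg _ (by positivity)]
      exact ENNReal.rpow_le_rpow (by exact_mod_cast ht.1) (by positivity)
    · rw [ENNReal.coe_inv (by positivity), ENNReal.inv_le_inv]
      exact_mod_cast ht.2.le
  have hmain : ∀ c : ℝ≥0, 0 < c → olModular p Φ (fun x => f x / (c : ℝ)) ≤ 1 →
      (c : ℝ≥0∞)⁻¹ * (α * P) ≤ M := by
    intro c hc hmod
    refine hM _ ?_
    set y := youngExt Φ ((c : ℝ≥0∞)⁻¹ * (α * P))
    have h1 : ∫⁻ t in Set.Ico T (2 * T), y / ((2 * T : ℝ≥0) : ℝ≥0∞) ∂lebesgueNN ≤ 1 := by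
      rw [olModular_div hc] at hmod
      refine le_trans (le_trans ?_ (setLIntegral_le_lintegral (Set.Ico T (2 * T)) _)) hmod
      refine setLIntegral_mono' measurableSet_Ico fun t ht => ?_
      refine ENNReal.div_le_div (hΦ.monotone_youngExt ?_) (by exact_mod_cast ht.2.le)
      gcongr
      exact hW t ht
    have h2 : lebesgueNN (Set.Ico T (2 * T)) = T := by
      have : Set.Ico T (2 * T) = Set.Ici T ∩ {r : ℝ≥0 | (r : ℝ≥0∞) < (2 * T : ℝ≥0)} := by
        ext r; simp only [Set.mem_Ico, Set.mem_inter_iff, Set.mem_Ici, Set.mem_ofPred_eq,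
          ENNReal.coe_lt_coe]
      rw [this, lebesgueNN_Ici_inter_setOf_coe_lt, ← ENNReal.coe_sub, two_mul,
        add_tsub_cancel_right]
    rw [setLIntegral_const, h2] at h1
    have h3 : y / ((2 * T : ℝ≥0) : ℝ≥0∞) * T = y / 2 := by
      have hT' : (T : ℝ≥0∞) ≠ 0 := by exact_mod_cast hT.ne'
      rw [ENNReal.coe_mul, mul_comm, ← mul_div_assoc, mul_comm (T : ℝ≥0∞) y,
        ENNReal.mul_div_mul_right _ _ hT' ENNReal.coe_ne_top]
      rfl
    rw [h3] at h1
    have := ENNReal.div_le_iff (by norm_num) (by norm_num) |>.1 h1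
    simpa using this
  have hα' : (α : ℝ≥0∞) ≠ 0 := by exact_mod_cast hα.ne'
  have hC : ((M * α⁻¹ : ℝ≥0) : ℝ≥0∞) ≠ 0 := by
    have : M * α⁻¹ ≠ 0 := by positivity
    exact_mod_cast this
  rw [← ENNReal.inv_mul_le_iff hC ENNReal.coe_ne_top]
  refine le_iInf fun c => le_iInf fun hc => le_iInf fun hmod => ?_
  rw [ENNReal.inv_mul_le_iff hC ENNReal.coe_ne_top]
  have h := hmain c hc hmod
  rw [ENNReal.inv_mul_le_iff (by exact_mod_cast hc.ne') ENNReal.coe_ne_top, mul_comm,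
    ← ENNReal.le_div_iff_mul_le (Or.inl hα') (Or.inl ENNReal.coe_ne_top)] at h
  refine h.trans (le_of_eq ?_)
  rw [ENNReal.coe_mul M, ENNReal.coe_inv hα.ne', div_eq_mul_inv]
  ring

theorem olNorm_eq_zero_iff (hp : 0 < p) (hΦ : IsYoung Φ) (hf : AEMeasurable f lebesgueNN) :
    olNorm p Φ f = 0 ↔ f =ᵐ[lebesgueNN] 0 := by
  constructor
  · intro h
    have hz : ∀ n : ℕ, ∀ᵐ x ∂lebesgueNN, x ∈ Set.Iio (n : ℝ≥0) → f x = 0 := by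
      intro n
      obtain ⟨C, -, hC⟩ := exists_setLIntegral_enorm_le_olNorm (E := Set.Iio (n : ℝ≥0)) hp hΦ
        (by rw [lebesgueNN_Iio]; exact ENNReal.coe_lt_top)
      have := hC f hf
      rw [h, mul_zero, nonpos_iff_eq_zero, lintegral_eq_zero_iff' hf.enorm.restrict,
        Filter.EventuallyEq, ae_restrict_iff' measurableSet_Iio] at this
      filter_upwards [this] with x hx hxn
      simpa using hx hxn
    filter_upwards [ae_all_iff.2 hz] with x hx
    obtain ⟨n, hn⟩ := exists_nat_gt x
    exact hx n hn
  · intro h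
    rw [← nonpos_iff_eq_zero, ← olNorm_zero (p := p) hΦ]
    refine olNorm_mono hΦ ?_
    filter_upwards [h] with x hx
    rw [hx]

theorem olNorm_fatou (hΦ : IsYoung Φ) {F : ℕ → ℝ≥0 → ℝ} (hF : ∀ n, AEMeasurable (F n) lebesgueNN)
    (h : ∀ᵐ x ∂lebesgueNN, (∀ n, 0 ≤ F n x) ∧ Monotone (fun n => F n x) ∧
      Tendsto (fun n => F n x) atTop (𝓝 (f x))) :
    Monotone (fun n => olNorm p Φ (F n)) ∧
      Tendsto (fun n => olNorm p Φ (F n)) atTop (𝓝 (olNorm p Φ f)) := by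
  have habs : ∀ m n, m ≤ n → ∀ᵐ x ∂lebesgueNN, |F m x| ≤ |F n x| := by
    intro m n hmn
    filter_upwards [h] with x hx
    exact abs_le_abs_of_nonneg (hx.1 m) (hx.2.1 hmn)
  have hmono : Monotone (fun n => olNorm p Φ (F n)) := fun m n hmn =>
    olNorm_mono hΦ (habs m n hmn)
  refine ⟨hmono, ?_⟩
  suffices hs : olNorm p Φ f = ⨆ n, olNorm p Φ (F n) by
    rw [hs]
    exact tendsto_atTop_iSup hmono
  refine le_antisymm (le_of_forall_gt fun y hy => ?_) (iSup_le fun n => olNorm_mono hΦ ?_)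
  · obtain ⟨c, hc, hcy⟩ := ENNReal.lt_iff_exists_nnreal_btwn.1 hy
    have hc0 : 0 < c := by exact_mod_cast lt_of_le_of_lt zero_le hc
    refine lt_of_le_of_lt (olNorm_le hc0 ?_) hcy
    have hmod : ∀ n, olModular p Φ (fun x => F n x / (c : ℝ)) ≤ 1 := fun n =>
      olModular_le_one_of_olNorm_lt hΦ ((le_iSup _ n).trans_lt hc)
    simp only [olModular_div hc0] at hmod ⊢
    refine le_of_tendsto (lintegral_tendsto_of_tendsto_of_monotone ?_ ?_ ?_)
      (.of_forall hmod)
    · intro n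
      have hm := hΦ.monotone_youngExt.measurable
      have hW := measurable_scaledMaxRearr p (F n)
      fun_prop
    · refine .of_forall fun t m n hmn => ENNReal.div_le_div_right (hΦ.monotone_youngExt ?_) _
      gcongr
      exact scaledMaxRearr_le_of_distr_le (distr_mono (habs m n hmn)) t
    · filter_upwards [ae_pos_lebesgueNN] with t ht
      have ht' : (t : ℝ≥0∞) ≠ 0 := by exact_mod_cast ht.ne'
      have h1 := tendsto_rearrPrim hF h t
      have h2 : Tendsto (fun n => scaledMaxRearr p (F n) t) atTop (𝓝 (scaledMaxRearr p f t)) := by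
        simp only [scaledMaxRearr_eq, ← mul_assoc]
        refine ENNReal.Tendsto.const_mul h1 (Or.inr (ENNReal.mul_ne_top ?_ ?_))
        · rw [← ENNReal.coe_rpow_of_ne_zero ht.ne']
          exact ENNReal.coe_ne_top
        · exact ENNReal.inv_ne_top.2 ht'
      refine ENNReal.Tendsto.div_const ?_ (Or.inr ht')
      exact (hΦ.continuous_youngExt.tendsto _).comp
        (ENNReal.Tendsto.const_mul h2 (Or.inr (ENNReal.inv_ne_top.2 (by exact_mod_cast hc0.ne'))))
  · filter_upwards [h] with x hx
    exact abs_le_abs_of_nonneg (hx.1 n) (hx.2.1.ge_of_tendsto hx.2.2 n)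

/-- The values of `f*` at positive `t` determine the distribution function at every level. -/
theorem distr_eq_of_rearr_eq {Ω : Type*} [MeasurableSpace Ω] {μ : Measure Ω} {f g : Ω → ℝ}
    (h : ∀ t : ℝ≥0, 0 < t → rearr μ f t = rearr μ g t) (r : ℝ≥0) :
    distr μ f r = distr μ g r := by
  have key : ∀ {f g : Ω → ℝ}, (∀ t : ℝ≥0, 0 < t → rearr μ f t = rearr μ g t) →
      distr μ f r ≤ distr μ g r := by
    intro f g h
    by_contra! hlt
    obtain ⟨t, h1, h2⟩ := ENNReal.lt_iff_exists_nnreal_btwn.1 hlt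
    have ht : 0 < t := by exact_mod_cast lt_of_le_of_lt zero_le h1
    have := coe_lt_rearr_iff.2 h2
    rw [h t ht] at this
    exact absurd h1 (not_lt.2 (coe_lt_rearr_iff.1 this).le)
  exact le_antisymm (key h) (key fun t ht => (h t ht).symm)

/-! ### Dilations -/

theorem scaledMaxRearr_dilation {r : ℝ≥0} (hr : 0 < r) (f : ℝ≥0 → ℝ) {t : ℝ≥0} (ht : 0 < t) :
    scaledMaxRearr p (dilation r f) t =
      ((r ^ (1 / p) : ℝ≥0) : ℝ≥0∞)⁻¹ * scaledMaxRearr p f (r * t) := by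
  have hr' : (r : ℝ≥0∞) ≠ 0 := by exact_mod_cast hr.ne'
  have ht' : (t : ℝ≥0∞) ≠ 0 := by exact_mod_cast ht.ne'
  have h1 : ∀ s, distr lebesgueNN (dilation r f) s = (r : ℝ≥0∞)⁻¹ * distr lebesgueNN f s :=
    fun s => lebesgueNN_preimage_mul hr {x | (s : ℝ) < |f x|}
  have h2 : rearrPrim lebesgueNN (dilation r f) t =
      (r : ℝ≥0∞)⁻¹ * rearrPrim lebesgueNN f (r * t) := by
    rw [rearrPrim, rearrPrim, ← lintegral_const_mul _ (measurable_min_distr f _)]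
    refine lintegral_congr fun s => ?_
    rw [h1, mul_min, ENNReal.coe_mul, ← mul_assoc, ENNReal.inv_mul_cancel hr' ENNReal.coe_ne_top,
      one_mul]
  have h3 : (r ^ (1 / p) : ℝ≥0) ≠ 0 := by positivity
  rw [scaledMaxRearr_eq, scaledMaxRearr_eq, h2, ENNReal.coe_mul,
    ENNReal.mul_inv (Or.inl hr') (Or.inr ht'),
    ENNReal.mul_rpow_of_ne_top ENNReal.coe_ne_top ENNReal.coe_ne_top,
    ← ENNReal.coe_rpow_of_ne_zero hr.ne']
  have h4 : ((r ^ (1 / p) : ℝ≥0) : ℝ≥0∞)⁻¹ * ((r ^ (1 / p) : ℝ≥0) : ℝ≥0∞) = 1 :=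
    ENNReal.inv_mul_cancel (by exact_mod_cast h3) ENNReal.coe_ne_top
  calc _ = 1 * ((t : ℝ≥0∞) ^ (1 / p) * ((t : ℝ≥0∞)⁻¹ * ((r : ℝ≥0∞)⁻¹ *
        rearrPrim lebesgueNN f (r * t)))) := by rw [one_mul]
    _ = _ := by rw [← h4]; ring

theorem isPHomogeneous_olNorm (hΦ : IsYoung Φ) : IsPHomogeneous p (olNorm p Φ) := by
  intro f _ r hr
  set κ : ℝ≥0 := r ^ (1 / p)
  have hκ : 0 < κ := by positivity
  have h1 : olNorm p Φ (dilation r f) = olNorm p Φ (fun x => f x / (κ : ℝ)) := by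
    refine iInf_congr fun c => iInf_congr fun hc => ?_
    suffices hs : olModular p Φ (fun x => dilation r f x / (c : ℝ)) =
        olModular p Φ (fun x => f x / (κ : ℝ) / (c : ℝ)) by rw [hs]
    rw [olModular_div hc, olModular_div hc]
    simp only [scaledMaxRearr_div hκ]
    have hr' : (r : ℝ≥0∞) ≠ 0 := by exact_mod_cast hr.ne'
    have h2 := lintegral_lebesgueNN_comp_mul hr fun t : ℝ≥0 =>
      youngExt Φ ((c : ℝ≥0∞)⁻¹ * ((κ : ℝ≥0∞)⁻¹ * scaledMaxRearr p f t)) / (t : ℝ≥0∞)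
    have h3 : ∀ y : ℝ≥0∞, (r : ℝ≥0∞) * ((r : ℝ≥0∞)⁻¹ * y) = y := fun y => by
      rw [← mul_assoc, ENNReal.mul_inv_cancel hr' ENNReal.coe_ne_top, one_mul]
    -- The measure `dt/t` is invariant under dilations.
    rw [← h3 (∫⁻ t, youngExt Φ ((c : ℝ≥0∞)⁻¹ * ((κ : ℝ≥0∞)⁻¹ * scaledMaxRearr p f t)) /
      (t : ℝ≥0∞) ∂lebesgueNN), ← h2, ← lintegral_const_mul' _ _ ENNReal.coe_ne_top]
    refine lintegral_congr_ae ?_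
    filter_upwards [ae_pos_lebesgueNN] with t ht
    have ht' : (t : ℝ≥0∞) ≠ 0 := by exact_mod_cast ht.ne'
    rw [scaledMaxRearr_dilation hr f ht, ENNReal.coe_mul, ← mul_div_assoc,
      ENNReal.mul_div_mul_left _ _ hr' ENNReal.coe_ne_top]
  have h2 : (fun x => f x / (κ : ℝ)) = ((κ : ℝ)⁻¹) • f := by
    ext x
    simp [div_eq_inv_mul]
  rw [h1, h2, olNorm_smul hΦ]
  congr 1
  rw [abs_of_nonneg (by positivity), ENNReal.ofReal_inv_of_pos (by exact_mod_cast hκ),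
    ENNReal.ofReal_coe_nnreal, ENNReal.rpow_neg, ENNReal.coe_rpow_of_ne_zero hr.ne']

end

/-! ### The profile `min (t ^ (1/p), 1, (t/B) ^ (1/p - 1))` -/

theorem setLIntegral_lebesgueNN {S : Set ℝ≥0} (hS : MeasurableSet S) (g : ℝ≥0 → ℝ≥0∞) :
    ∫⁻ t in S, g t ∂lebesgueNN =
      ∫⁻ x in Set.Ioi (0 : ℝ) ∩ Real.toNNReal ⁻¹' S, g x.toNNReal := by
  rw [← lintegral_indicator hS, lintegral_lebesgueNN, Set.inter_comm,
    ← setLIntegral_indicator (measurable_real_toNNReal hS)]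
  rfl

/-- The profile `min (t ^ (1/p), 1, (t/B) ^ (1/p - 1))`: it is `1` between `1` and `B`, and decays
like a power on both sides, so that its integral against `dt/t` is `log B + O(1)`. -/
def plateau (p : ℝ) (B t : ℝ≥0) : ℝ≥0 :=
  min 1 (min (t ^ (1 / p)) ((t / B) ^ (1 / p - 1)))

theorem lintegral_Ioc_rpow {p : ℝ} (hp : 1 < p) :
    ∫⁻ x in Set.Ioc (0 : ℝ) 1, ENNReal.ofReal (x ^ (1 / p - 1)) = ENNReal.ofReal p := by
  have h1 : -1 < 1 / p - 1 := by have : 0 < 1 / p := by positivity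
                                 linarith
  have hi : IntegrableOn (fun x : ℝ => x ^ (1 / p - 1)) (Set.Ioc 0 1) := by
    rw [← intervalIntegrable_iff_integrableOn_Ioc_of_le zero_le_one]
    exact intervalIntegral.intervalIntegrable_rpow' h1
  rw [← ofReal_integral_eq_lintegral_ofReal hi, ← intervalIntegral.integral_of_le zero_le_one,
    integral_rpow (Or.inl h1)]
  · congr 1
    have : (1 / p - 1 + 1) ≠ 0 := by simp; linarith
    rw [Real.zero_rpow this]
    simp
  · filter_upwards [ae_restrict_mem measurableSet_Ioc] with x hx
    exact Real.rpow_nonneg hx.1.le _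

theorem lintegral_Ioc_inv {B : ℝ} (hB : 1 ≤ B) :
    ∫⁻ x in Set.Ioc (1 : ℝ) B, ENNReal.ofReal x⁻¹ = ENNReal.ofReal (Real.log B) := by
  have hi : IntegrableOn (fun x : ℝ => x⁻¹) (Set.Ioc 1 B) := by
    rw [← intervalIntegrable_iff_integrableOn_Ioc_of_le hB]
    refine intervalIntegral.intervalIntegrable_inv (fun x hx => ?_) continuousOn_id
    rw [Set.uIcc_of_le hB] at hx
    exact (zero_lt_one.trans_le hx.1).ne'
  rw [← ofReal_integral_eq_lintegral_ofReal hi, ← intervalIntegral.integral_of_le hB,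
    integral_inv_of_pos one_pos (by linarith), div_one]
  filter_upwards [ae_restrict_mem measurableSet_Ioc] with x hx
  exact inv_nonneg.2 (zero_le_one.trans hx.1.le)

theorem lintegral_Ioi_rpow {p : ℝ} (hp : 1 < p) {B : ℝ} (hB : 0 < B) :
    ∫⁻ x in Set.Ioi B, ENNReal.ofReal (B ^ (1 - 1 / p) * x ^ (1 / p - 2)) =
      ENNReal.ofReal (p / (p - 1)) := by
  have hp1 : 1 / p < 1 := (div_lt_one (by linarith)).2 hp
  have h1 : 1 / p - 2 < -1 := by linarith
  have hi : IntegrableOn (fun x : ℝ => B ^ (1 - 1 / p) * x ^ (1 / p - 2)) (Set.Ioi B) :=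
    (integrableOn_Ioi_rpow_of_lt h1 hB).const_mul _
  rw [← ofReal_integral_eq_lintegral_ofReal hi, integral_const_mul,
    integral_Ioi_rpow_of_lt h1 hB]
  · congr 1
    rw [show 1 / p - 2 + 1 = -(1 - 1 / p) by ring, Real.rpow_neg hB.le]
    have : B ^ (1 - 1 / p) ≠ 0 := (Real.rpow_pos_of_pos hB _).ne'
    have h3 : p - 1 ≠ 0 := by linarith
    have h4 : p ≠ 0 := by linarith
    field_simp
  · filter_upwards [ae_restrict_mem measurableSet_Ioi] with x hx
    have : 0 < x := hB.trans hx
    positivity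

theorem lintegral_plateau_le {p : ℝ} (hp : 1 < p) {B : ℝ≥0} (hB : 1 ≤ B) :
    ∫⁻ t : ℝ≥0, (plateau p B t : ℝ≥0∞) / (t : ℝ≥0∞) ∂lebesgueNN ≤
      ENNReal.ofReal (p + Real.log B + p / (p - 1)) := by
  have hB' : (1 : ℝ) ≤ B := by exact_mod_cast hB
  have hB0 : (0 : ℝ) < B := by linarith
  have hBn : 0 < B := by positivity
  have hpp : 0 < p / (p - 1) := div_pos (by linarith) (by linarith)
  have hp0 : 0 < p := by linarith
  have hq : ∀ {x : ℝ}, 0 < x → ∀ y : ℝ≥0,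
      (y : ℝ≥0∞) / (x.toNNReal : ℝ≥0∞) = ENNReal.ofReal (y / x) := by
    intro x hx y
    rw [ENNReal.ofReal_div_of_pos hx, ENNReal.ofReal_coe_nnreal]
    rfl
  have hpl1 : ∀ t, plateau p B t ≤ 1 := fun t => min_le_left _ _
  have hpl2 : ∀ t, plateau p B t ≤ t ^ (1 / p) := fun t =>
    (min_le_right _ _).trans (min_le_left _ _)
  have hpl3 : ∀ t, plateau p B t ≤ (t / B) ^ (1 / p - 1) := fun t =>
    (min_le_right _ _).trans (min_le_right _ _)
  have hsplit : Set.Ioi (0 : ℝ) = Set.Ioc 0 1 ∪ Set.Ioc 1 (B : ℝ) ∪ Set.Ioi (B : ℝ) := by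
    rw [Set.Ioc_union_Ioc_eq_Ioc zero_le_one hB', Set.Ioc_union_Ioi_eq_Ioi hB0.le]
  rw [lintegral_lebesgueNN, hsplit,
    ENNReal.ofReal_add (add_nonneg hp0.le (Real.log_nonneg hB')) hpp.le,
    ENNReal.ofReal_add hp0.le (Real.log_nonneg hB')]
  refine (lintegral_union_le _ _ _).trans (add_le_add ((lintegral_union_le _ _ _).trans
    (add_le_add ?_ ?_)) ?_)
  · rw [← lintegral_Ioc_rpow hp]
    refine setLIntegral_mono' measurableSet_Ioc fun x hx => ?_
    rw [hq hx.1]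
    refine ENNReal.ofReal_le_ofReal ?_
    rw [Real.rpow_sub_one hx.1.ne']
    refine div_le_div_of_nonneg_right ?_ hx.1.le
    have := NNReal.coe_le_coe.2 (hpl2 x.toNNReal)
    rwa [NNReal.coe_rpow, Real.coe_toNNReal _ hx.1.le] at this
  · rw [← lintegral_Ioc_inv hB']
    refine setLIntegral_mono' measurableSet_Ioc fun x hx => ?_
    have hx0 : 0 < x := zero_lt_one.trans hx.1
    rw [hq hx0, ← one_div]
    refine ENNReal.ofReal_le_ofReal (div_le_div_of_nonneg_right ?_ hx0.le)
    exact_mod_cast hpl1 _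
  · rw [← lintegral_Ioi_rpow hp hB0]
    refine setLIntegral_mono' measurableSet_Ioi fun x hx => ?_
    have hx0 : 0 < x := hB0.trans hx
    rw [hq hx0]
    refine ENNReal.ofReal_le_ofReal ?_
    rw [show 1 / p - 2 = 1 / p - 1 - 1 by ring, Real.rpow_sub_one hx0.ne', ← mul_div_assoc]
    refine div_le_div_of_nonneg_right ?_ hx0.le
    have := NNReal.coe_le_coe.2 (hpl3 x.toNNReal)
    rw [NNReal.coe_rpow, NNReal.coe_div, Real.coe_toNNReal _ hx0.le,
      Real.div_rpow hx0.le hB0.le] at this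
    refine this.trans (le_of_eq ?_)
    rw [show 1 - 1 / p = -(1 / p - 1) by ring, Real.rpow_neg hB0.le, div_eq_inv_mul]

section

variable {p : ℝ} {Φ Ψ : ℝ → ℝ}

/-- By convexity `Φ (k θ) ≤ θ Φ k` for the values `θ ≤ 1` of the profile, so the modular is bounded
by `Φ k` times the integral of the profile. -/
theorem olModular_le_of_scaledMaxRearr_le (hp : 1 < p) (hΦ : IsYoung Φ) {B k : ℝ≥0} (hB : 1 ≤ B)
    {f : ℝ≥0 → ℝ}
    (h : ∀ t : ℝ≥0, 0 < t → scaledMaxRearr p f t ≤ (k * plateau p B t : ℝ≥0)) :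
    olModular p Φ f ≤ ENNReal.ofReal (Φ k * (p + Real.log B + p / (p - 1))) := by
  rw [ENNReal.ofReal_mul (hΦ.nonneg k.coe_nonneg)]
  refine le_trans ?_ (mul_le_mul_right (lintegral_plateau_le hp hB) _)
  rw [olModular_eq, ← lintegral_const_mul' _ _ ENNReal.ofReal_ne_top]
  refine lintegral_mono_ae ?_
  filter_upwards [ae_pos_lebesgueNN] with t ht
  rw [← mul_div_assoc]
  refine ENNReal.div_le_div_right ((hΦ.monotone_youngExt (h t ht)).trans ?_) _
  rw [mul_comm k, ENNReal.coe_mul, ← IsYoung.youngExt_coe, mul_comm (youngExt Φ k)]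
  exact hΦ.youngExt_mul_le (by exact_mod_cast min_le_left _ _) _

/-! ### The Orlicz–Lorentz norm is rearrangement-invariant -/

theorem olNorm_indicator_lt_top (hp : 1 < p) (hΦ : IsYoung Φ) {E : Set ℝ≥0}
    (hE : lebesgueNN E < ∞) : olNorm p Φ (E.indicator fun _ => (1 : ℝ)) < ∞ := by
  set m : ℝ≥0 := max 1 (lebesgueNN E).toNNReal
  have hEm : lebesgueNN E ≤ m := by
    rw [← ENNReal.coe_toNNReal hE.ne]
    exact_mod_cast le_max_right _ _
  have hm1 : 1 ≤ m := le_max_left _ _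
  set f : ℝ≥0 → ℝ := E.indicator fun _ => (1 : ℝ)
  have hd : ∀ r : ℝ≥0, distr lebesgueNN f r ≤ if r < 1 then (m : ℝ≥0∞) else 0 := by
    intro r
    split_ifs with hr
    · refine (measure_mono fun x hx => ?_).trans hEm
      by_contra hxE
      have hx' : (r : ℝ) < |f x| := hx
      simp only [f, Set.indicator_of_notMem hxE, abs_zero] at hx'
      exact absurd hx' (not_lt.2 r.coe_nonneg)
    · refine le_of_eq ((measure_mono_null fun x hx => ?_) measure_empty)
      refine absurd (show (r : ℝ) < |f x| from hx) (not_lt.2 ?_)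
      have h1 : (1 : ℝ) ≤ r := by exact_mod_cast not_lt.1 hr
      refine le_trans ?_ h1
      by_cases hxE : x ∈ E <;> simp [f, hxE]
  have hP : ∀ t : ℝ≥0, rearrPrim lebesgueNN f t ≤ (min m t : ℝ≥0) := by
    intro t
    calc rearrPrim lebesgueNN f t
        ≤ ∫⁻ r, (Set.Iio (1 : ℝ≥0)).indicator (fun _ => ((min m t : ℝ≥0) : ℝ≥0∞)) r
          ∂lebesgueNN := by
          refine lintegral_mono fun r => (min_le_min_right _ (hd r)).trans ?_
          by_cases hr : r < 1
          · simp [hr]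
          · simp [hr]
      _ = _ := by
          rw [lintegral_indicator_const measurableSet_Iio, lebesgueNN_Iio]
          simp
  have hp0 : 0 < p := by linarith
  have hW : ∀ t : ℝ≥0, 0 < t → scaledMaxRearr p f t ≤ (m * plateau p 1 t : ℝ≥0) := by
    intro t ht
    have hp1 : 1 / p - 1 < 0 := by
      have : 1 / p < 1 := (div_lt_one hp0).2 hp
      linarith
    have h1 : t ^ (1 / p) * t⁻¹ = t ^ (1 / p - 1) := by
      rw [NNReal.rpow_sub_one ht.ne', ← div_eq_mul_inv]
    have hle : scaledMaxRearr p f t ≤ ((t ^ (1 / p) * (t⁻¹ * min m t) : ℝ≥0) : ℝ≥0∞) := by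
      rw [scaledMaxRearr_eq, ENNReal.coe_mul, ENNReal.coe_mul, ENNReal.coe_inv ht.ne',
        ENNReal.coe_rpow_of_ne_zero ht.ne']
      gcongr
      exact hP t
    refine hle.trans (ENNReal.coe_le_coe.2 ?_)
    rw [plateau, div_one, mul_min m, mul_min m, mul_one]
    have hA : t ^ (1 / p) * (t⁻¹ * min m t) ≤ t ^ (1 / p) := by
      refine mul_le_of_le_one_right' ?_
      rw [inv_mul_le_iff₀ ht, mul_one]
      exact min_le_right _ _
    have hB : t ^ (1 / p) * (t⁻¹ * min m t) ≤ m * t ^ (1 / p - 1) := by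
      rw [← mul_assoc, h1, mul_comm]
      gcongr
      exact min_le_left _ _
    refine le_min ?_ (le_min (hA.trans (le_mul_of_one_le_left' hm1)) hB)
    rcases le_total t 1 with h | h
    · exact hA.trans ((NNReal.rpow_le_one h (by positivity)).trans hm1)
    · exact hB.trans (mul_le_of_le_one_right' (NNReal.rpow_le_one_of_one_le_of_nonpos h hp1.le))
  obtain ⟨A, hA⟩ : ∃ A : ℝ, A = Φ 1 * (p + Real.log (1 : ℝ≥0) + p / (p - 1)) := ⟨_, rfl⟩
  -- Scaling down by `c` gains a factor `1 / c` in the modular, by convexity.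
  set c : ℝ≥0 := max m (m * A.toNNReal)
  have hc : 0 < c := by positivity
  have hmc : m / c ≤ 1 := div_le_one_of_le₀ (le_max_left _ _) zero_le
  refine lt_of_le_of_lt (olNorm_le hc ?_) (ENNReal.coe_lt_top (r := c))
  refine (olModular_le_of_scaledMaxRearr_le hp hΦ (k := m / c) le_rfl fun t ht => ?_).trans ?_
  · rw [scaledMaxRearr_div hc, ENNReal.inv_mul_le_iff (by exact_mod_cast hc.ne')
      ENNReal.coe_ne_top, ← ENNReal.coe_mul, ← mul_assoc, mul_div_cancel₀ _ hc.ne']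
    exact hW t ht
  · refine ENNReal.ofReal_le_one.2 ?_
    have hpp : 0 < p / (p - 1) := div_pos (by linarith) (by linarith)
    have h1 := hΦ.map_mul_le (θ := ((m / c : ℝ≥0) : ℝ)) (x := 1) (by positivity)
      (by exact_mod_cast hmc) zero_le_one
    rw [mul_one] at h1
    have h0 : 0 ≤ p + Real.log (1 : ℝ≥0) + p / (p - 1) := by simp; positivity
    refine (mul_le_mul_of_nonneg_right h1 h0).trans ?_
    rw [mul_assoc, ← hA]
    have hA' : A ≤ A.toNNReal := Real.le_coe_toNNReal A
    have hcA : (m : ℝ) * A.toNNReal ≤ c := by exact_mod_cast le_max_right _ _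
    have hc' : (0 : ℝ) < c := by exact_mod_cast hc
    rw [NNReal.coe_div, div_mul_eq_mul_div, div_le_one hc']
    exact (mul_le_mul_of_nonneg_left hA' m.coe_nonneg).trans hcA

/-- Every Young function gives a rearrangement-invariant Orlicz–Lorentz norm. -/
theorem isRINorm_olNorm (hp : 1 < p) (hΦ : IsYoung Φ) :
    IsRINorm lebesgueNN (olNorm p Φ) where
  add_le f g hf hg := olNorm_add_le hΦ hf hg
  smul_eq a f _ := olNorm_smul hΦ a f
  eq_zero_iff f hf := olNorm_eq_zero_iff (by linarith) hΦ hf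
  mono f g _ _ h := olNorm_mono hΦ (h.mono fun x hx => abs_le_abs_of_nonneg hx.1 hx.2)
  fatou F f hF _ h := olNorm_fatou hΦ hF h
  indicator_lt_top E _ hE := olNorm_indicator_lt_top hp hΦ hE
  lintegral_le E _ hE := by
    obtain ⟨C, hC0, hC⟩ := exists_setLIntegral_enorm_le_olNorm (by linarith : 0 < p) hΦ hE
    refine ⟨C, hC0, fun f hf _ => le_trans (lintegral_mono fun x => ?_) (hC f hf)⟩
    rw [Real.enorm_eq_ofReal_abs]
    exact ENNReal.ofReal_le_ofReal (le_abs_self _)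
  rearr_inv f g _ _ h := le_antisymm
    (olNorm_le_of_distr_le hΦ fun r => (distr_eq_of_rearr_eq h r).le)
    (olNorm_le_of_distr_le hΦ fun r => (distr_eq_of_rearr_eq h r).ge)

/-! ### Failure of inclusions -/

/-- Gliding hump: functions with values in `[0, 1]`, bounded in the first norm and unbounded in the
second, are summed with weights `2 ^ (-k)` to separate the two spaces. The bound by `1` makes the
sum converge pointwise. -/
theorem not_spaceOf_subset {Ω : Type*} [MeasurableSpace Ω] {μ : Measure Ω}
    {N₁ N₂ : (Ω → ℝ) → ℝ≥0∞} (h₁ : IsRINorm μ N₁) (h₂ : IsRINorm μ N₂)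
    (h : ∀ C : ℝ≥0, ∃ f : Ω → ℝ, Measurable f ∧ (∀ x, 0 ≤ f x ∧ f x ≤ 1) ∧ N₁ f ≤ 1 ∧
      (C : ℝ≥0∞) ≤ N₂ f) : ¬ spaceOf μ N₁ ⊆ spaceOf μ N₂ := by
  -- `4 ^ k` still dominates after the weight `2 ^ (-k)`.
  choose f hfm hf01 hf1 hf2 using fun k : ℕ => h (4 ^ k)
  set F : ℕ → Ω → ℝ := fun n => ∑ k ∈ Finset.range n, ((1 / 2 : ℝ) ^ k) • f k
  set G : Ω → ℝ := fun x => ∑' k, (1 / 2 : ℝ) ^ k * f k x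
  have hsum : ∀ x, Summable fun k => (1 / 2 : ℝ) ^ k * f k x := fun x =>
    Summable.of_nonneg_of_le (fun k => mul_nonneg (by positivity) (hf01 k x).1)
      (fun k => mul_le_of_le_one_right (by positivity) (hf01 k x).2) summable_geometric_two
  have hFx : ∀ n x, F n x = ∑ k ∈ Finset.range n, (1 / 2 : ℝ) ^ k * f k x := by
    intro n x
    simp [F, Finset.sum_apply]
  have hFm : ∀ n, Measurable (F n) := fun n => by
    rw [show F n = fun x => ∑ k ∈ Finset.range n, (1 / 2 : ℝ) ^ k * f k x from funext (hFx n)]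
    exact Finset.measurable_sum _ fun k _ => (hfm k).const_mul _
  have hlim : ∀ x, Tendsto (fun n => F n x) atTop (𝓝 (G x)) := by
    intro x
    simp only [hFx]
    exact (hsum x).hasSum.tendsto_sum_nat
  have hGm : Measurable G := measurable_of_tendsto_metrizable hFm (tendsto_pi_nhds.2 hlim)
  have hFN : ∀ n, N₁ (F n) ≤ ∑ k ∈ Finset.range n, (2⁻¹ : ℝ≥0∞) ^ k := by
    intro n
    induction n with
    | zero =>
      have h0 : N₁ 0 = 0 := (h₁.eq_zero_iff 0 aemeasurable_zero).2 (ae_eq_refl _)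
      simp [F, h0]
    | succ n ih =>
      have hs : F (n + 1) = F n + ((1 / 2 : ℝ) ^ n) • f n := Finset.sum_range_succ _ _
      rw [hs, Finset.sum_range_succ]
      refine (h₁.add_le _ _ (hFm n).aemeasurable ((hfm n).const_smul _).aemeasurable).trans
        (add_le_add ih ?_)
      rw [h₁.smul_eq _ _ (hfm n).aemeasurable, abs_of_nonneg (by positivity),
        ENNReal.ofReal_pow (by positivity), one_div, ENNReal.ofReal_inv_of_pos two_pos]
      simpa using mul_le_mul_right (hf1 n) _
  have hFat := h₁.fatou F G (fun n => (hFm n).aemeasurable) hGm.aemeasurable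
    (.of_forall fun x => ⟨fun n => ?_, fun m n hmn => ?_, hlim x⟩)
  rotate_left
  · rw [hFx]
    exact Finset.sum_nonneg fun k _ => mul_nonneg (by positivity) (hf01 k x).1
  · simp only [hFx]
    exact Finset.sum_le_sum_of_subset_of_nonneg (Finset.range_mono hmn)
      fun k _ _ => mul_nonneg (by positivity) (hf01 k x).1
  have hG1 : N₁ G ≤ 2 := by
    refine le_of_tendsto hFat.2 (.of_forall fun n => (hFN n).trans ?_)
    refine (ENNReal.sum_le_tsum _).trans (le_of_eq ?_)
    rw [ENNReal.tsum_geometric, ENNReal.one_sub_inv_two, inv_inv]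
  intro hsub
  have hG2 : N₂ G < ∞ := (hsub ⟨hGm.aemeasurable, hG1.trans_lt (by norm_num)⟩).2
  refine hG2.ne (ENNReal.eq_top_of_forall_nnreal_le fun r => ?_)
  obtain ⟨k, hk⟩ := pow_unbounded_of_one_lt r one_lt_two
  have hle : N₂ (((1 / 2 : ℝ) ^ k) • f k) ≤ N₂ G := by
    refine h₂.mono _ _ hGm.aemeasurable ((hfm k).const_smul _).aemeasurable
      (.of_forall fun x => ⟨mul_nonneg (by positivity) (hf01 k x).1, ?_⟩)
    exact (hsum x).le_tsum k fun j _ => mul_nonneg (by positivity) (hf01 j x).1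
  refine le_trans ?_ hle
  rw [h₂.smul_eq _ _ (hfm k).aemeasurable, abs_of_nonneg (by positivity),
    ENNReal.ofReal_pow (by positivity), one_div, ENNReal.ofReal_inv_of_pos two_pos]
  refine le_trans ?_ (mul_le_mul_right (hf2 k) _)
  have h4 : (ENNReal.ofReal 2)⁻¹ ^ k * ((4 ^ k : ℝ≥0) : ℝ≥0∞) = ((2 ^ k : ℝ≥0) : ℝ≥0∞) := by
    have : (4 : ℝ≥0∞) ^ k = 2 ^ k * 2 ^ k := by rw [← mul_pow]; norm_num
    push_cast
    rw [this, ← mul_assoc, ← mul_pow]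
    norm_num [ENNReal.inv_mul_cancel]
  rw [h4]
  exact_mod_cast hk.le

/-- The decreasing function `ε min (1, x ^ (-1/p))`, set to `0` from `B` on. It is equal to its own
rearrangement, and `t ^ (1/p) f*(t)` has the constant value `ε` on `[1, B)`. -/
def cutoffPower (p : ℝ) (ε B : ℝ≥0) (x : ℝ≥0) : ℝ :=
  if x < B then (ε * (max 1 x) ^ (-(1 / p)) : ℝ≥0) else 0

section cutoffPower
variable {ε B : ℝ≥0}

theorem measurable_cutoffPower : Measurable (cutoffPower p ε B) := by
  unfold cutoffPower
  refine Measurable.ite measurableSet_Iio ?_ measurable_const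
  fun_prop

theorem cutoffPower_nonneg (x : ℝ≥0) : 0 ≤ cutoffPower p ε B x := by
  unfold cutoffPower
  split_ifs
  · exact NNReal.coe_nonneg _
  · exact le_rfl

theorem enorm_cutoffPower (x : ℝ≥0) : ‖cutoffPower p ε B x‖ₑ =
    (Set.Iio B).indicator (fun x => ((ε * (max 1 x) ^ (-(1 / p)) : ℝ≥0) : ℝ≥0∞)) x := by
  unfold cutoffPower
  by_cases h : x < B
  · rw [if_pos h, Set.indicator_of_mem (show x ∈ Set.Iio B from h)]
    exact NNReal.enorm_eq _
  · rw [if_neg h, Set.indicator_of_notMem (show x ∉ Set.Iio B from h)]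
    simp

theorem cutoffPower_le (hp : 0 < p) (x : ℝ≥0) : cutoffPower p ε B x ≤ ε := by
  unfold cutoffPower
  split_ifs
  · refine NNReal.coe_le_coe.2 (mul_le_of_le_one_right' ?_)
    exact NNReal.rpow_le_one_of_one_le_of_nonpos (le_max_left _ _) (by
      have : 0 < 1 / p := by positivity
      linarith)
  · exact ε.coe_nonneg

theorem setLIntegral_Iio_rpow_le (hp : 1 < p) (t : ℝ≥0) :
    ∫⁻ x in Set.Iio t, ((ε * (max 1 x) ^ (-(1 / p)) : ℝ≥0) : ℝ≥0∞) ∂lebesgueNN ≤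
      ((ε * ((p / (p - 1)).toNNReal * t ^ (1 - 1 / p)) : ℝ≥0) : ℝ≥0∞) := by
  have hp0 : 0 < p := by linarith
  have hp1 : 1 / p < 1 := (div_lt_one hp0).2 hp
  have h1 : -1 < -(1 / p) := by linarith
  have hi : IntegrableOn (fun x : ℝ => x ^ (-(1 / p))) (Set.Ioc 0 (t : ℝ)) := by
    rw [← intervalIntegrable_iff_integrableOn_Ioc_of_le t.coe_nonneg]
    exact intervalIntegral.intervalIntegrable_rpow' h1
  simp only [ENNReal.coe_mul ε]
  rw [lintegral_const_mul' _ _ ENNReal.coe_ne_top, setLIntegral_lebesgueNN measurableSet_Iio]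
  gcongr
  have hsub : Set.Ioi (0 : ℝ) ∩ Real.toNNReal ⁻¹' Set.Iio t ⊆ Set.Ioc 0 (t : ℝ) := by
    rintro x ⟨hx0, hxt⟩
    refine ⟨hx0, ?_⟩
    have : x.toNNReal < t := hxt
    exact ((Real.toNNReal_lt_iff_lt_coe (le_of_lt hx0)).1 this).le
  refine (lintegral_mono_set hsub).trans ?_
  have hle : ∫⁻ x in Set.Ioc 0 (t : ℝ), ((max 1 x.toNNReal ^ (-(1 / p)) : ℝ≥0) : ℝ≥0∞) ≤
      ∫⁻ x in Set.Ioc 0 (t : ℝ), ENNReal.ofReal (x ^ (-(1 / p))) := by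
    refine setLIntegral_mono' measurableSet_Ioc fun x hx => ?_
    rw [← ENNReal.ofReal_coe_nnreal]
    refine ENNReal.ofReal_le_ofReal ?_
    rw [NNReal.coe_rpow]
    refine Real.rpow_le_rpow_of_nonpos hx.1 ?_ (by have : 0 < 1 / p := by positivity
                                                   linarith)
    exact (Real.le_coe_toNNReal x).trans (by exact_mod_cast le_max_right _ _)
  refine hle.trans (le_of_eq ?_)
  rw [← ofReal_integral_eq_lintegral_ofReal hi, ← intervalIntegral.integral_of_le t.coe_nonneg,
    integral_rpow (Or.inl h1), ← ENNReal.ofReal_coe_nnreal]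
  · congr 1
    have h2 : (-(1 / p) + 1) ≠ 0 := by linarith
    rw [Real.zero_rpow h2, NNReal.coe_mul, NNReal.coe_rpow, Real.coe_toNNReal _
      (div_nonneg hp0.le (by linarith)), show -(1 / p) + 1 = 1 - 1 / p by ring]
    have h3 : p - 1 ≠ 0 := by linarith
    have h4 : p ≠ 0 := by linarith
    field_simp
    ring
  · filter_upwards [ae_restrict_mem measurableSet_Ioc] with x hx
    exact Real.rpow_nonneg hx.1.le _

theorem rearrPrim_cutoffPower_le_mul (hp : 0 < p) (t : ℝ≥0) :
    rearrPrim lebesgueNN (cutoffPower p ε B) t ≤ (t * ε : ℝ≥0) := by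
  refine (rearrPrim_le measurable_cutoffPower.aemeasurable t ε).trans (le_of_eq ?_)
  have h : ∀ x, ‖cutoffPower p ε B x‖ₑ - (ε : ℝ≥0∞) = 0 := fun x => by
    refine tsub_eq_zero_of_le ?_
    rw [Real.enorm_eq_ofReal (cutoffPower_nonneg x), ← ENNReal.ofReal_coe_nnreal]
    exact ENNReal.ofReal_le_ofReal (cutoffPower_le hp x)
  simp [h]

/-- The variational bound at the level `c = ε t ^ (-1/p)`, which the function exceeds only
on `[0, t)`. -/
theorem rearrPrim_cutoffPower_le_rpow (hp : 1 < p) {t : ℝ≥0} (ht : 1 ≤ t) :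
    rearrPrim lebesgueNN (cutoffPower p ε B) t ≤
      (ε * ((1 + (p / (p - 1)).toNNReal) * t ^ (1 - 1 / p)) : ℝ≥0) := by
  have hp0 : 0 < 1 / p := by have : 0 < p := by linarith
                             positivity
  have ht0 : t ≠ 0 := (zero_lt_one.trans_le ht).ne'
  refine (rearrPrim_le measurable_cutoffPower.aemeasurable t (ε * t ^ (-(1 / p)))).trans ?_
  rw [add_mul, mul_add, ENNReal.coe_add]
  refine add_le_add (le_of_eq ?_) (le_trans ?_ (setLIntegral_Iio_rpow_le hp t))
  · rw [← ENNReal.coe_mul, ENNReal.coe_inj, sub_eq_add_neg, NNReal.rpow_add ht0, NNReal.rpow_one]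
    ring
  · rw [← lintegral_indicator measurableSet_Iio]
    refine lintegral_mono fun x => ?_
    rw [enorm_cutoffPower]
    by_cases hx : x < t
    · rw [Set.indicator_of_mem (show x ∈ Set.Iio t from hx)]
      exact tsub_le_self.trans (Set.indicator_le_self _ _ x)
    · rw [Set.indicator_of_notMem (show x ∉ Set.Iio t from hx), nonpos_iff_eq_zero]
      refine tsub_eq_zero_of_le ((Set.indicator_le_self _ _ x).trans (ENNReal.coe_le_coe.2 ?_))
      have hle : t ≤ max 1 x := (not_lt.1 hx).trans (le_max_right _ _)
      rw [NNReal.rpow_neg, NNReal.rpow_neg]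
      gcongr

theorem rearrPrim_cutoffPower_le_total (hp : 1 < p) (t : ℝ≥0) :
    rearrPrim lebesgueNN (cutoffPower p ε B) t ≤
      (ε * ((p / (p - 1)).toNNReal * B ^ (1 - 1 / p)) : ℝ≥0) := by
  refine (rearrPrim_le measurable_cutoffPower.aemeasurable t 0).trans ?_
  refine le_trans (le_of_eq ?_) (setLIntegral_Iio_rpow_le hp B)
  rw [← lintegral_indicator measurableSet_Iio]
  simp [enorm_cutoffPower]

theorem scaledMaxRearr_cutoffPower_le (hp : 1 < p) {t : ℝ≥0} (ht : 0 < t) :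
    scaledMaxRearr p (cutoffPower p ε B) t ≤
      ((1 + (p / (p - 1)).toNNReal) * ε * plateau p B t : ℝ≥0) := by
  have hp0 : 0 < 1 / p := by have : 0 < p := by linarith
                             positivity
  set M : ℝ≥0 := 1 + (p / (p - 1)).toNNReal
  have hM : 1 ≤ M := le_add_of_nonneg_right zero_le
  have key : ∀ A : ℝ≥0, rearrPrim lebesgueNN (cutoffPower p ε B) t ≤ A →
      scaledMaxRearr p (cutoffPower p ε B) t ≤ ((t ^ (1 / p) * (t⁻¹ * A) : ℝ≥0) : ℝ≥0∞) := by
    intro A hA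
    rw [scaledMaxRearr_eq, ENNReal.coe_mul, ENNReal.coe_mul, ENNReal.coe_inv ht.ne',
      ENNReal.coe_rpow_of_ne_zero ht.ne']
    gcongr
  have hpow : t ^ (1 / p) * t ^ (1 - 1 / p) = t := by
    rw [← NNReal.rpow_add ht.ne', add_sub_cancel, NNReal.rpow_one]
  have h1 : scaledMaxRearr p (cutoffPower p ε B) t ≤ (M * ε * t ^ (1 / p) : ℝ≥0) := by
    refine (key _ (rearrPrim_cutoffPower_le_mul (by linarith) t)).trans (ENNReal.coe_le_coe.2 ?_)
    rw [inv_mul_cancel_left₀ ht.ne', mul_comm, mul_assoc]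
    exact le_mul_of_one_le_left' hM
  have h2 : scaledMaxRearr p (cutoffPower p ε B) t ≤ (M * ε * 1 : ℝ≥0) := by
    rcases le_total t 1 with h | h
    · refine h1.trans (ENNReal.coe_le_coe.2 ?_)
      gcongr
      exact NNReal.rpow_le_one h hp0.le
    · refine (key _ (rearrPrim_cutoffPower_le_rpow hp h)).trans (le_of_eq ?_)
      rw [ENNReal.coe_inj]
      calc t ^ (1 / p) * (t⁻¹ * (ε * (M * t ^ (1 - 1 / p))))
          = (t ^ (1 / p) * t ^ (1 - 1 / p)) * t⁻¹ * (M * ε) := by ring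
        _ = M * ε * 1 := by rw [hpow, mul_inv_cancel₀ ht.ne', one_mul, mul_one]
  have h3 : scaledMaxRearr p (cutoffPower p ε B) t ≤ (M * ε * (t / B) ^ (1 / p - 1) : ℝ≥0) := by
    refine (key _ (rearrPrim_cutoffPower_le_total hp t)).trans (ENNReal.coe_le_coe.2 ?_)
    have h4 : (t / B) ^ (1 / p - 1) = t ^ (1 / p) * t⁻¹ * B ^ (1 - 1 / p) := by
      rw [NNReal.div_rpow, NNReal.rpow_sub_one ht.ne', show 1 / p - 1 = -(1 - 1 / p) by ring,
        NNReal.rpow_neg, div_eq_mul_inv, inv_inv, div_eq_mul_inv (t ^ (1 / p)) t]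
    rw [h4]
    calc t ^ (1 / p) * (t⁻¹ * (ε * ((p / (p - 1)).toNNReal * B ^ (1 - 1 / p))))
        = (p / (p - 1)).toNNReal * ε * (t ^ (1 / p) * t⁻¹ * B ^ (1 - 1 / p)) := by ring
      _ ≤ _ := by
        gcongr
        exact le_add_of_nonneg_left zero_le
  rw [plateau, mul_min (M * ε), mul_min (M * ε), ENNReal.coe_min, ENNReal.coe_min]
  exact le_min h2 (le_min h1 h3)

theorem le_scaledMaxRearr_cutoffPower {t : ℝ≥0} (hp : 0 < p) (ht : 1 ≤ t) (htB : t ≤ B) :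
    (ε : ℝ≥0∞) ≤ scaledMaxRearr p (cutoffPower p ε B) t := by
  have hp0 : 0 < 1 / p := by positivity
  have ht0 : t ≠ 0 := (zero_lt_one.trans_le ht).ne'
  have hP : ((t * (ε * t ^ (-(1 / p))) : ℝ≥0) : ℝ≥0∞) ≤
      rearrPrim lebesgueNN (cutoffPower p ε B) t := by
    calc ((t * (ε * t ^ (-(1 / p))) : ℝ≥0) : ℝ≥0∞)
        = ∫⁻ _r in Set.Iio (ε * t ^ (-(1 / p))), (t : ℝ≥0∞) ∂lebesgueNN := by
          rw [setLIntegral_const, lebesgueNN_Iio, ENNReal.coe_mul]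
      _ ≤ ∫⁻ r in Set.Iio (ε * t ^ (-(1 / p))),
            min (distr lebesgueNN (cutoffPower p ε B) r) t ∂lebesgueNN := by
          refine setLIntegral_mono' measurableSet_Iio fun r hr => le_min ?_ le_rfl
          rw [← lebesgueNN_Iio t]
          refine measure_mono fun x hx => ?_
          have hxt : x < t := hx
          change (r : ℝ) < |cutoffPower p ε B x|
          rw [abs_of_nonneg (cutoffPower_nonneg x), cutoffPower, if_pos (hxt.trans_le htB),
            NNReal.coe_lt_coe]
          refine lt_of_lt_of_le (show r < _ from hr) ?_
          rw [NNReal.rpow_neg, NNReal.rpow_neg]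
          have : max 1 x ≤ t := max_le ht hxt.le
          gcongr
      _ ≤ _ := setLIntegral_le_lintegral _ _
  calc (ε : ℝ≥0∞) = ((t ^ (1 / p) * (t⁻¹ * (t * (ε * t ^ (-(1 / p))))) : ℝ≥0) : ℝ≥0∞) := by
        rw [ENNReal.coe_inj, inv_mul_cancel_left₀ ht0, mul_left_comm, ← NNReal.rpow_add ht0,
          add_neg_cancel, NNReal.rpow_zero, mul_one]
    _ ≤ _ := by
        rw [scaledMaxRearr_eq, ENNReal.coe_mul, ENNReal.coe_mul, ENNReal.coe_inv ht0,
          ENNReal.coe_rpow_of_ne_zero ht0]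
        gcongr

theorem le_olModular_cutoffPower_div (hp : 0 < p) (hΨ : IsYoung Ψ) {c : ℝ≥0} (hc : 0 < c)
    (hB : 1 ≤ B) : ENNReal.ofReal (Ψ (c⁻¹ * ε : ℝ≥0) * Real.log B) ≤
      olModular p Ψ (fun x => cutoffPower p ε B x / (c : ℝ)) := by
  have hB' : (1 : ℝ) ≤ B := by exact_mod_cast hB
  rw [olModular_div hc]
  refine le_trans ?_ (setLIntegral_le_lintegral (Set.Icc 1 B) _)
  have h1 : Real.toNNReal ⁻¹' Set.Icc 1 B ∩ Set.Ioi (0 : ℝ) = Set.Icc 1 (B : ℝ) := by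
    ext x
    simp only [Set.mem_inter_iff, Set.mem_preimage, Set.mem_Icc, Set.mem_Ioi, Real.one_le_toNNReal,
      Real.toNNReal_le_iff_le_coe]
    constructor
    · exact fun h => h.1
    · exact fun h => ⟨h, zero_lt_one.trans_le h.1⟩
  have h2 : ∫⁻ t in Set.Icc (1 : ℝ≥0) B, (t : ℝ≥0∞)⁻¹ ∂lebesgueNN =
      ENNReal.ofReal (Real.log B) := by
    rw [setLIntegral_lebesgueNN measurableSet_Icc, Set.inter_comm, h1,
      setLIntegral_congr Ioc_ae_eq_Icc.symm, ← lintegral_Ioc_inv hB']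
    refine setLIntegral_congr_fun measurableSet_Ioc fun x hx => ?_
    rw [ENNReal.ofReal_inv_of_pos (zero_lt_one.trans hx.1)]
    rfl
  rw [ENNReal.ofReal_mul (hΨ.nonneg (NNReal.coe_nonneg _)), ← h2,
    ← lintegral_const_mul' _ _ ENNReal.ofReal_ne_top]
  refine setLIntegral_mono' measurableSet_Icc fun t ht => ?_
  rw [← div_eq_mul_inv, ← IsYoung.youngExt_coe]
  refine ENNReal.div_le_div_right (hΨ.monotone_youngExt ?_) _
  rw [ENNReal.coe_mul, ENNReal.coe_inv hc.ne']
  gcongr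
  exact le_scaledMaxRearr_cutoffPower hp ht.1 ht.2

end cutoffPower

/-- If no inequality `Ψ x ≤ D Φ (D x)` holds near `0`, then `L^{p,Φ}` is not contained in
`L^{p,Ψ}`. -/
theorem not_olSpace_subset (hp : 1 < p) (hΦ : IsYoung Φ) (hΨ : IsYoung Ψ)
    (H : ∀ D : ℝ, 0 < D → ∃ x : ℝ, 0 < x ∧ Φ (D * x) ≤ 1 / D ∧ D * Φ (D * x) < Ψ x) :
    ¬ olSpace p Φ ⊆ olSpace p Ψ := by
  refine not_spaceOf_subset (isRINorm_olNorm hp hΦ) (isRINorm_olNorm hp hΨ) fun C₀ => ?_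
  have hp0 : 0 < p := by linarith
  have hpp : 0 < p / (p - 1) := div_pos hp0 (by linarith)
  -- The test function has height `ε = C x`, where `x` comes from `H` for a large `D`: dividing by
  -- `C` leaves `Ψ x`, while the constant `M` lost in bounding `f**` is absorbed by `D ≥ M C`.
  set C : ℝ≥0 := max 1 C₀
  have hC : 1 ≤ C := le_max_left _ _
  have hC' : (1 : ℝ) ≤ C := by exact_mod_cast hC
  set M : ℝ≥0 := 1 + (p / (p - 1)).toNNReal
  have hΦ1 := hΦ.pos one_pos
  obtain ⟨D, hD1, hD2, hD3, hD4, hD5⟩ : ∃ D : ℝ, (M * C : ℝ≥0) ≤ D ∧ 2 * (p + p / (p - 1)) ≤ D ∧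
      2 ≤ D ∧ 1 / Φ 1 < D ∧ (C : ℝ) ≤ D := by
    refine ⟨max (max (M * C : ℝ≥0) (2 * (p + p / (p - 1)))) (max 2 (max (1 / Φ 1 + 1) C)),
      ?_, ?_, ?_, ?_, ?_⟩
    · exact (le_max_left _ _).trans (le_max_left _ _)
    · exact (le_max_right _ _).trans (le_max_left _ _)
    · exact (le_max_left _ _).trans (le_max_right _ _)
    · exact (lt_add_one _).trans_le ((le_max_left _ _).trans
        ((le_max_right _ _).trans (le_max_right _ _)))
    · exact (le_max_right _ _).trans ((le_max_right _ _).trans (le_max_right _ _))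
  have hD0 : 0 < D := by linarith
  obtain ⟨x, hx0, hx1, hx2⟩ := H D hD0
  have hDx : D * x < 1 := by
    by_contra! h
    have h1 : Φ 1 ≤ Φ (D * x) :=
      hΦ.strictMonoOn.monotoneOn (Set.mem_Ici.2 zero_le_one) (Set.mem_Ici.2 (by linarith)) h
    have h2 : 1 / D < Φ 1 := by
      rw [div_lt_iff₀ hΦ1] at hD4
      rw [div_lt_iff₀ hD0]
      linarith
    linarith
  lift x to ℝ≥0 using hx0.le
  set y := Φ (D * x)
  have hy : 0 < y := hΦ.pos (mul_pos hD0 hx0)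
  -- The length `log B` of the plateau is chosen so that the `Φ`-modular is just at most `1`.
  set B : ℝ≥0 := (Real.exp (1 / (2 * y))).toNNReal
  have hBc : (B : ℝ) = Real.exp (1 / (2 * y)) := Real.coe_toNNReal _ (Real.exp_pos _).le
  have hB : 1 ≤ B := by
    have : (1 : ℝ) ≤ B := by
      rw [hBc]
      exact Real.one_le_exp (by positivity)
    exact_mod_cast this
  have hlog : Real.log B = 1 / (2 * y) := by rw [hBc, Real.log_exp]
  refine ⟨cutoffPower p (C * x) B, measurable_cutoffPower,
    fun z => ⟨cutoffPower_nonneg z, (cutoffPower_le hp0 z).trans ?_⟩, ?_, ?_⟩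
  · push_cast
    exact (mul_le_mul_of_nonneg_right hD5 x.coe_nonneg).trans hDx.le
  · have h1 : olModular p Φ (cutoffPower p (C * x) B) ≤ 1 := by
      refine (olModular_le_of_scaledMaxRearr_le hp hΦ hB
        fun t ht => scaledMaxRearr_cutoffPower_le hp ht).trans ?_
      refine ENNReal.ofReal_le_one.2 ?_
      have h2 : Φ ((M * (C * x) : ℝ≥0) : ℝ) ≤ y := by
        refine hΦ.strictMonoOn.monotoneOn (Set.mem_Ici.2 (NNReal.coe_nonneg _))
          (Set.mem_Ici.2 (mul_pos hD0 hx0).le) ?_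
        rw [← mul_assoc, NNReal.coe_mul]
        exact mul_le_mul_of_nonneg_right hD1 x.coe_nonneg
      rw [hlog]
      have h3 : 0 ≤ p + 1 / (2 * y) + p / (p - 1) := by positivity
      refine (mul_le_mul_of_nonneg_right h2 h3).trans ?_
      have h4 : y * (p + p / (p - 1)) ≤ 1 / 2 := by
        rw [le_div_iff₀ hD0] at hx1
        have := mul_le_mul_of_nonneg_left hD2 hy.le
        linarith
      have h5 : y * (1 / (2 * y)) = 1 / 2 := by field_simp
      linarith
    have := olNorm_le (p := p) (Φ := Φ) (f := cutoffPower p (C * x) B) one_pos (by simpa using h1)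
    simpa using this
  · refine le_trans (ENNReal.coe_le_coe.2 (le_max_right 1 C₀)) ?_
    by_contra! hlt
    have h1 := olModular_le_one_of_olNorm_lt hΨ hlt
    have h2 := (le_olModular_cutoffPower_div hp0 hΨ (zero_lt_one.trans_le hC) hB).trans h1
    rw [ENNReal.ofReal_le_one, inv_mul_cancel_left₀ (zero_lt_one.trans_le hC).ne', hlog] at h2
    have h3 : Ψ x * (1 / (2 * y)) = Ψ x / (2 * y) := by ring
    rw [h3, div_le_one (by positivity)] at h2
    have h4 : 2 * y ≤ D * y := mul_le_mul_of_nonneg_right hD3 hy.le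
    linarith

end

/-! ### The oscillating Young function -/

/-- The derivative of `oscPhi` at `x ∈ (0, e⁻¹]`, as a function of `u = -log x`. -/
def oscSlope (u : ℝ) : ℝ :=
  Real.exp (u - u * (4 + Real.sin (Real.log u))) *
    (4 + Real.sin (Real.log u) + Real.cos (Real.log u))

theorem oscSlope_pos (u : ℝ) : 0 < oscSlope u := by
  have h1 := Real.neg_one_le_sin (Real.log u)
  have h2 := Real.neg_one_le_cos (Real.log u)
  exact mul_pos (Real.exp_pos _) (by linarith)

theorem hasDerivAt_mul_sin_log {u : ℝ} (hu : 0 < u) :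
    HasDerivAt (fun u => u * (4 + Real.sin (Real.log u)))
      (4 + Real.sin (Real.log u) + Real.cos (Real.log u)) u := by
  have h := (hasDerivAt_id u).mul (((Real.hasDerivAt_log hu.ne').sin).const_add 4)
  refine h.congr_deriv ?_
  simp only [id]
  field_simp

theorem antitoneOn_oscSlope : AntitoneOn oscSlope (Set.Ici 1) := by
  have hd : ∀ u : ℝ, 0 < u → HasDerivAt oscSlope
      (Real.exp (u - u * (4 + Real.sin (Real.log u))) *
        ((1 - (4 + Real.sin (Real.log u) + Real.cos (Real.log u))) *
          (4 + Real.sin (Real.log u) + Real.cos (Real.log u)) +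
          (Real.cos (Real.log u) - Real.sin (Real.log u)) / u)) u := by
    intro u hu
    have h1 := ((hasDerivAt_id u).sub (hasDerivAt_mul_sin_log hu)).exp
    have h2 := (((Real.hasDerivAt_log hu.ne').sin).const_add 4).add
      (Real.hasDerivAt_log hu.ne').cos
    refine (h1.mul h2).congr_deriv ?_
    simp only [id, Pi.sub_apply, Pi.add_apply]
    field_simp
    ring
  have hpos : ∀ u ∈ Set.Ici (1 : ℝ), 0 < u := fun u hu => zero_lt_one.trans_le hu
  refine antitoneOn_of_deriv_nonpos (convex_Ici 1)
    (fun u hu => (hd u (hpos u hu)).continuousAt.continuousWithinAt)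
    (fun u hu => (hd u (hpos u (interior_subset hu))).differentiableAt.differentiableWithinAt)
    fun u hu => ?_
  have hu1 : (1 : ℝ) ≤ u := interior_subset hu
  rw [(hd u (by linarith)).deriv]
  refine mul_nonpos_of_nonneg_of_nonpos (Real.exp_pos _).le ?_
  set S := Real.sin (Real.log u)
  set C := Real.cos (Real.log u)
  have hS1 : -1 ≤ S := Real.neg_one_le_sin _
  have hC1 : -1 ≤ C := Real.neg_one_le_cos _
  have hC2 : C ≤ 1 := Real.cos_le_one _
  have h1 : (C - S) / u ≤ 2 := by
    rw [div_le_iff₀ (by linarith)]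
    linarith
  nlinarith

theorem oscPhi_of_le {a b x : ℝ} (hx : 0 < x) (hx1 : x ≤ Real.exp (-1)) : oscPhi a b x =
    Real.exp (-(-Real.log x * (4 + Real.sin (Real.log (-Real.log x))))) := by
  rw [oscPhi, if_neg (not_le.2 hx), if_pos hx1, Real.rpow_def_of_pos hx]
  congr 1
  ring

theorem one_le_neg_log {x : ℝ} (hx : 0 < x) (hx1 : x ≤ Real.exp (-1)) : 1 ≤ -Real.log x := by
  have := Real.log_le_log hx hx1
  rw [Real.log_exp] at this
  linarith

/-- The slope that makes `oscPhi` continuously differentiable at `e⁻¹`. -/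
def oscA : ℝ := 5 * Real.exp (-3)

/-- The intercept that makes `oscPhi` continuous at `e⁻¹`. -/
def oscB : ℝ := 4 * Real.exp (-4)

theorem oscA_mul_exp_sub : oscA * Real.exp (-1) - oscB = Real.exp (-4) := by
  have : Real.exp (-4) = Real.exp (-3) * Real.exp (-1) := by
    rw [← Real.exp_add]; norm_num
  rw [oscA, oscB, this]
  ring

theorem oscSlope_one : oscSlope 1 = oscA := by
  rw [oscSlope, oscA]
  norm_num
  ring

theorem oscPhi_of_ge {x : ℝ} (hx : Real.exp (-1) ≤ x) :
    oscPhi oscA oscB x = oscA * x - oscB := by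
  rcases eq_or_lt_of_le hx with rfl | hx
  · rw [oscPhi_of_le (Real.exp_pos _) le_rfl, oscA_mul_exp_sub]
    norm_num
  · rw [oscPhi, if_neg (not_le.2 ((Real.exp_pos _).trans hx)), if_neg (not_le.2 hx)]

theorem hasDerivAt_oscPhi {x : ℝ} (hx : 0 < x) : HasDerivAt (oscPhi oscA oscB)
    (if x ≤ Real.exp (-1) then oscSlope (-Real.log x) else oscA) x := by
  have hleft : x ≤ Real.exp (-1) →
      HasDerivAt (fun x => Real.exp (-(-Real.log x * (4 + Real.sin (Real.log (-Real.log x))))))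
        (oscSlope (-Real.log x)) x := by
    intro hx1
    have hu : 0 < -Real.log x := zero_lt_one.trans_le (one_le_neg_log hx hx1)
    have h := ((hasDerivAt_mul_sin_log hu).comp x (Real.hasDerivAt_log hx.ne').neg).neg.exp
    refine h.congr_deriv ?_
    simp only [Function.comp, Pi.neg_apply]
    rw [oscSlope, sub_eq_add_neg, Real.exp_add, Real.exp_neg (Real.log x), Real.exp_log hx]
    ring
  have hright : HasDerivAt (fun x => oscA * x - oscB) oscA x := by
    simpa using ((hasDerivAt_id x).const_mul oscA).sub_const oscB
  have heq1 : ∀ y ∈ Set.Iic (Real.exp (-1)) ∩ Set.Ioi 0, oscPhi oscA oscB y =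
      Real.exp (-(-Real.log y * (4 + Real.sin (Real.log (-Real.log y))))) :=
    fun y hy => oscPhi_of_le hy.2 hy.1
  rcases lt_trichotomy x (Real.exp (-1)) with h | h | h
  · rw [if_pos h.le]
    refine (hleft h.le).congr_of_eventuallyEq ?_
    filter_upwards [Ioo_mem_nhds hx h] with y hy using heq1 y ⟨hy.2.le, hy.1⟩
  · rw [if_pos h.le]
    have h1 : HasDerivWithinAt (oscPhi oscA oscB) (oscSlope (-Real.log x))
        (Set.Iic (Real.exp (-1))) x := by
      refine (hleft h.le).hasDerivWithinAt.congr_of_eventuallyEq ?_ (heq1 x ⟨h.le, hx⟩)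
      filter_upwards [self_mem_nhdsWithin, mem_nhdsWithin_of_mem_nhds (Ioi_mem_nhds hx)]
        with y hy1 hy2 using heq1 y ⟨hy1, hy2⟩
    have h2 : HasDerivWithinAt (oscPhi oscA oscB) (oscSlope (-Real.log x))
        (Set.Ici (Real.exp (-1))) x := by
      have : oscSlope (-Real.log x) = oscA := by rw [h, Real.log_exp, neg_neg, oscSlope_one]
      rw [this]
      exact hright.hasDerivWithinAt.congr (fun y hy => oscPhi_of_ge hy) (oscPhi_of_ge h.ge)
    have := h1.union h2
    rwa [Set.Iic_union_Ici, hasDerivWithinAt_univ] at this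
  · rw [if_neg (not_le.2 h)]
    refine hright.congr_of_eventuallyEq ?_
    filter_upwards [Ioi_mem_nhds h] with y hy using oscPhi_of_ge (le_of_lt hy)

theorem oscPhi_zero (a b : ℝ) : oscPhi a b 0 = 0 := by simp [oscPhi]

theorem continuousOn_oscPhi : ContinuousOn (oscPhi oscA oscB) (Set.Ici 0) := by
  intro x hx
  rcases eq_or_lt_of_le (show (0 : ℝ) ≤ x from hx) with rfl | hx
  · rw [ContinuousWithinAt, oscPhi_zero]
    have hev : ∀ᶠ y in 𝓝[Set.Ici 0] (0 : ℝ), 0 ≤ oscPhi oscA oscB y ∧ oscPhi oscA oscB y ≤ y := by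
      filter_upwards [self_mem_nhdsWithin,
        mem_nhdsWithin_of_mem_nhds (Iic_mem_nhds (Real.exp_pos (-1)))] with y hy0 hy1
      rcases eq_or_lt_of_le (show (0 : ℝ) ≤ y from hy0) with rfl | hy
      · simp [oscPhi_zero]
      · rw [oscPhi_of_le hy hy1]
        refine ⟨(Real.exp_pos _).le, ?_⟩
        conv_rhs => rw [← Real.exp_log hy]
        refine Real.exp_le_exp.2 ?_
        have h1 := one_le_neg_log hy hy1
        have h2 := Real.neg_one_le_sin (Real.log (-Real.log y))
        nlinarith
    have hid : Tendsto (fun y : ℝ => y) (𝓝[Set.Ici 0] 0) (𝓝 0) :=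
      tendsto_id.mono_left nhdsWithin_le_nhds
    exact tendsto_of_tendsto_of_tendsto_of_le_of_le' tendsto_const_nhds hid
      (hev.mono fun _ h => h.1) (hev.mono fun _ h => h.2)
  · exact (hasDerivAt_oscPhi hx).continuousAt.continuousWithinAt

theorem oscA_pos : 0 < oscA := by unfold oscA; positivity

theorem isYoung_oscPhi : IsYoung (oscPhi oscA oscB) where
  convexOn := by
    refine MonotoneOn.convexOn_of_deriv (convex_Ici 0) continuousOn_oscPhi ?_ ?_ <;>
      rw [interior_Ici]
    · exact fun x hx => (hasDerivAt_oscPhi hx).differentiableAt.differentiableWithinAt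
    · intro x hx y hy hxy
      rw [(hasDerivAt_oscPhi hx).deriv, (hasDerivAt_oscPhi hy).deriv]
      by_cases hy1 : y ≤ Real.exp (-1)
      · rw [if_pos (hxy.trans hy1), if_pos hy1]
        exact antitoneOn_oscSlope (one_le_neg_log hy hy1)
          (one_le_neg_log hx (hxy.trans hy1)) (neg_le_neg (Real.log_le_log hx hxy))
      · rw [if_neg hy1]
        split_ifs with hx1
        · rw [← oscSlope_one]
          exact antitoneOn_oscSlope Set.self_mem_Ici (one_le_neg_log hx hx1)
            (one_le_neg_log hx hx1)
        · exact le_rfl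
  strictMonoOn := by
    refine strictMonoOn_of_deriv_pos (convex_Ici 0) continuousOn_oscPhi fun x hx => ?_
    rw [interior_Ici] at hx
    rw [(hasDerivAt_oscPhi hx).deriv]
    split_ifs
    · exact oscSlope_pos _
    · exact oscA_pos
  map_zero := oscPhi_zero _ _

/-- The logarithmic derivative bound behind the `Δ₂` condition. -/
theorem mul_deriv_oscPhi_le {x : ℝ} (hx : 0 < x) :
    x * deriv (oscPhi oscA oscB) x ≤ 6 * oscPhi oscA oscB x := by
  rw [(hasDerivAt_oscPhi hx).deriv]
  split_ifs with h
  · have h1 : x * oscSlope (-Real.log x) = oscPhi oscA oscB x *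
        (4 + Real.sin (Real.log (-Real.log x)) + Real.cos (Real.log (-Real.log x))) := by
      rw [oscPhi_of_le hx h, oscSlope, sub_eq_add_neg, Real.exp_add, Real.exp_neg (Real.log x),
        Real.exp_log hx]
      field_simp
    rw [h1, mul_comm]
    refine mul_le_mul_of_nonneg_right ?_ (isYoung_oscPhi.nonneg hx.le)
    have := Real.sin_le_one (Real.log (-Real.log x))
    have := Real.cos_le_one (Real.log (-Real.log x))
    linarith
  · rw [oscPhi_of_ge (not_le.1 h).le]
    have h1 := oscA_mul_exp_sub
    have h2 : oscA * Real.exp (-1) ≤ oscA * x :=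
      mul_le_mul_of_nonneg_left (not_le.1 h).le oscA_pos.le
    have h3 : oscB = 4 * Real.exp (-4) := rfl
    have h4 := Real.exp_pos (-4)
    linarith

theorem satisfiesDelta2_oscPhi : SatisfiesDelta2 (oscPhi oscA oscB) := by
  have hd : ∀ x : ℝ, 0 < x → HasDerivAt (fun x => oscPhi oscA oscB x / x ^ 6)
      ((deriv (oscPhi oscA oscB) x * x ^ 6 - oscPhi oscA oscB x * (6 * x ^ 5)) /
        (x ^ 6) ^ 2) x := by
    intro x hx
    have := (hasDerivAt_oscPhi hx).differentiableAt.hasDerivAt.div (hasDerivAt_pow 6 x)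
      (pow_ne_zero 6 hx.ne')
    exact this.congr_deriv (by simp)
  have hanti : AntitoneOn (fun x => oscPhi oscA oscB x / x ^ 6) (Set.Ioi 0) := by
    refine antitoneOn_of_deriv_nonpos (convex_Ioi 0)
      (fun x hx => (hd x hx).continuousAt.continuousWithinAt)
      (fun x hx => (hd x (interior_subset hx)).differentiableAt.differentiableWithinAt)
      fun x hx => ?_
    have hx0 : 0 < x := interior_subset hx
    rw [(hd x hx0).deriv]
    refine div_nonpos_of_nonpos_of_nonneg ?_ (by positivity)
    have h1 := mul_le_mul_of_nonneg_left (mul_deriv_oscPhi_le hx0) (pow_pos hx0 5).le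
    linarith
  refine ⟨64, by norm_num, fun t ht => ?_⟩
  have h := hanti (Set.mem_Ioi.2 ht) (Set.mem_Ioi.2 (by linarith : 0 < 2 * t)) (by linarith)
  have h2 : oscPhi oscA oscB (2 * t) / (2 * t) ^ 6 ≤ oscPhi oscA oscB t / t ^ 6 := h
  rw [div_le_div_iff₀ (by positivity) (by positivity), mul_pow, ← mul_assoc] at h2
  have h3 := le_of_mul_le_mul_right h2 (pow_pos ht 6)
  linarith

/-- `u = exp (v + 2πn)` makes the exponent in `oscPhi` equal to `4 + sin v` at `x = exp (-u)`. -/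
theorem exists_oscPhi_eq_of_sin_eq {a b v s : ℝ} (hv : Real.sin v = s) (N : ℝ) :
    ∃ u : ℝ, N < u ∧ 1 ≤ u ∧ oscPhi a b (Real.exp (-u)) = Real.exp (-((4 + s) * u)) := by
  obtain ⟨n, hn⟩ := exists_nat_gt ((max 1 |N| - v) / (2 * Real.pi))
  rw [div_lt_iff₀ (by positivity)] at hn
  set w := v + n * (2 * Real.pi)
  have hw : max 1 |N| < w := by simp only [w]; linarith
  have hexp : w < Real.exp w := by
    have := Real.add_one_le_exp w
    linarith
  have h1 : 1 ≤ Real.exp w := ((le_max_left _ _).trans hw.le).trans hexp.le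
  refine ⟨Real.exp w, (((le_abs_self N).trans (le_max_right _ _)).trans_lt hw).trans hexp, h1, ?_⟩
  rw [oscPhi_of_le (Real.exp_pos _) (Real.exp_le_exp.2 (neg_le_neg h1)), Real.log_exp, neg_neg,
    Real.log_exp, Real.sin_add_nat_mul_two_pi, hv, mul_comm]

theorem exists_oscPhi_eq_exp_neg_three_mul (a b N : ℝ) :
    ∃ u : ℝ, N < u ∧ 1 ≤ u ∧ oscPhi a b (Real.exp (-u)) = Real.exp (-(3 * u)) := by
  have := exists_oscPhi_eq_of_sin_eq (a := a) (b := b) (v := -(Real.pi / 2)) (s := -1) (by simp) N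
  norm_num at this
  exact this

theorem exists_oscPhi_eq_exp_neg_five_mul (a b N : ℝ) :
    ∃ u : ℝ, N < u ∧ 1 ≤ u ∧ oscPhi a b (Real.exp (-u)) = Real.exp (-(5 * u)) := by
  have := exists_oscPhi_eq_of_sin_eq (a := a) (b := b) (v := Real.pi / 2) (s := 1) (by simp) N
  norm_num at this
  exact this

/-! ### Lorentz spaces as Orlicz–Lorentz spaces -/

theorem isYoung_rpow {q : ℝ} (hq : 1 ≤ q) : IsYoung fun x => x ^ q where
  convexOn := convexOn_rpow hq
  strictMonoOn := Real.strictMonoOn_rpow_Ici_of_exponent_pos (by linarith)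
  map_zero := Real.zero_rpow (by linarith)

theorem youngExt_rpow {q : ℝ} (hq : 0 < q) (y : ℝ≥0∞) : youngExt (fun x => x ^ q) y = y ^ q := by
  induction y with
  | top => rw [IsYoung.youngExt_top, ENNReal.top_rpow_of_pos hq]
  | coe y =>
    rw [IsYoung.youngExt_coe, ← ENNReal.ofReal_rpow_of_nonneg y.coe_nonneg hq.le,
      ENNReal.ofReal_coe_nnreal]

theorem olModular_rpow_div {p q : ℝ} (hq : 0 < q) {c : ℝ≥0} (hc : 0 < c) (f : ℝ≥0 → ℝ) :
    olModular p (fun x => x ^ q) (fun x => f x / (c : ℝ)) = ((c : ℝ≥0∞) ^ q)⁻¹ *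
      ∫⁻ t : ℝ≥0, maxRearr lebesgueNN f t ^ q * (t : ℝ≥0∞) ^ (q / p - 1) ∂lebesgueNN := by
  have hcq : ((c : ℝ≥0∞) ^ q)⁻¹ ≠ ∞ := by
    rw [← ENNReal.coe_rpow_of_ne_zero hc.ne']
    refine ENNReal.inv_ne_top.2 ?_
    have : c ^ q ≠ 0 := by positivity
    exact_mod_cast this
  rw [olModular_div hc, ← lintegral_const_mul' _ _ hcq]
  refine lintegral_congr_ae ?_
  filter_upwards [ae_pos_lebesgueNN] with t ht
  have ht' : (t : ℝ≥0∞) ≠ 0 := by exact_mod_cast ht.ne'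
  rw [youngExt_rpow hq, scaledMaxRearr, ENNReal.mul_rpow_of_nonneg _ _ hq.le,
    ENNReal.mul_rpow_of_nonneg _ _ hq.le, ENNReal.inv_rpow, ← ENNReal.rpow_mul,
    ENNReal.rpow_sub _ _ ht' ENNReal.coe_ne_top, ENNReal.rpow_one,
    show 1 / p * q = q / p by ring, div_eq_mul_inv,
    div_eq_mul_inv ((t : ℝ≥0∞) ^ (q / p))]
  ring

theorem lorentzSpace_eq_olSpace {p q : ℝ} (hq : 1 ≤ q) :
    lorentzSpace p q = olSpace p fun x => x ^ q := by
  have hq0 : 0 < q := by linarith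
  ext f
  refine and_congr_right fun _ => ?_
  rw [lorentzNorm, ENNReal.rpow_lt_top_iff_of_pos (by positivity)]
  have hmod := fun (c : ℝ≥0) (hc : 0 < c) => olModular_rpow_div (p := p) hq0 hc f
  set I := ∫⁻ t : ℝ≥0, maxRearr lebesgueNN f t ^ q * (t : ℝ≥0∞) ^ (q / p - 1) ∂lebesgueNN
  have hiff : ∀ c : ℝ≥0, 0 < c → (olModular p (fun x => x ^ q) (fun x => f x / (c : ℝ)) ≤ 1 ↔
      I ≤ ((c ^ q : ℝ≥0) : ℝ≥0∞)) := by
    intro c hc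
    have : c ^ q ≠ 0 := by positivity
    rw [hmod c hc, ← ENNReal.coe_rpow_of_ne_zero hc.ne',
      ENNReal.inv_mul_le_iff (by exact_mod_cast this) ENNReal.coe_ne_top, mul_one]
  constructor
  · intro hI
    set c : ℝ≥0 := max 1 I.toNNReal
    have hc1 : 1 ≤ c := le_max_left _ _
    refine lt_of_le_of_lt (olNorm_le (zero_lt_one.trans_le hc1)
      ((hiff c (zero_lt_one.trans_le hc1)).2 ?_)) ENNReal.coe_lt_top
    rw [← ENNReal.coe_toNNReal hI.ne]
    refine ENNReal.coe_le_coe.2 ((le_max_right 1 _).trans ?_)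
    have := NNReal.rpow_le_rpow_of_exponent_le hc1 hq
    rwa [NNReal.rpow_one] at this
  · intro hN
    simp only [olNorm, iInf_lt_iff] at hN
    obtain ⟨c, hc, hm, -⟩ := hN
    exact ((hiff c hc).1 hm).trans_lt ENNReal.coe_lt_top

/-! ### Comparison of the oscillating function with powers -/

theorem not_lorentzSpace_subset_olSpace_oscPhi {p q : ℝ} (hp : 1 < p) (hq : 3 < q) :
    ¬ lorentzSpace p q ⊆ olSpace p (oscPhi oscA oscB) := by
  rw [lorentzSpace_eq_olSpace (by linarith)]
  refine not_olSpace_subset hp (isYoung_rpow (by linarith)) isYoung_oscPhi fun D hD => ?_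
  obtain ⟨u, hu, hu1, hΦ⟩ := exists_oscPhi_eq_exp_neg_three_mul oscA oscB
    ((q + 1) * Real.log D / (q - 3))
  rw [div_lt_iff₀ (by linarith)] at hu
  have hpow : (D * Real.exp (-u)) ^ q = Real.exp (q * (Real.log D - u)) := by
    rw [Real.rpow_def_of_pos (by positivity), Real.log_mul hD.ne' (Real.exp_pos _).ne',
      Real.log_exp]
    congr 1
    ring
  have hDe : D = Real.exp (Real.log D) := (Real.exp_log hD).symm
  refine ⟨Real.exp (-u), Real.exp_pos _, ?_, ?_⟩
  · rw [hpow]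
    conv_rhs => rw [hDe, one_div, ← Real.exp_neg]
    refine Real.exp_le_exp.2 ?_
    linarith
  · rw [hΦ, hpow]
    conv_lhs => rw [hDe]
    rw [Real.log_exp, ← Real.exp_add]
    refine Real.exp_lt_exp.2 ?_
    linarith

theorem not_olSpace_oscPhi_subset_lorentzSpace {p q : ℝ} (hp : 1 < p) (hq : 1 ≤ q) (hq5 : q < 5) :
    ¬ olSpace p (oscPhi oscA oscB) ⊆ lorentzSpace p q := by
  rw [lorentzSpace_eq_olSpace hq]
  refine not_olSpace_subset hp isYoung_oscPhi (isYoung_rpow hq) fun D hD => ?_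
  obtain ⟨u, hu, hu1, hΦ⟩ := exists_oscPhi_eq_exp_neg_five_mul oscA oscB
    (max (Real.log D) ((q + 1) * Real.log D / (5 - q)))
  obtain ⟨hu2, hu3⟩ := max_lt_iff.1 hu
  rw [div_lt_iff₀ (by linarith)] at hu3
  have hDe : D = Real.exp (Real.log D) := (Real.exp_log hD).symm
  have hx : D * (Real.exp (-u) / D) = Real.exp (-u) := by field_simp
  have hpow : (Real.exp (-u) / D) ^ q = Real.exp (q * (-u - Real.log D)) := by
    rw [Real.rpow_def_of_pos (by positivity), Real.log_div (Real.exp_pos _).ne' hD.ne',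
      Real.log_exp]
    congr 1
    ring
  refine ⟨Real.exp (-u) / D, by positivity, ?_, ?_⟩
  · rw [hx, hΦ]
    conv_rhs => rw [hDe, one_div, ← Real.exp_neg]
    refine Real.exp_le_exp.2 ?_
    linarith
  · rw [hx, hΦ, hpow]
    conv_lhs => rw [hDe]
    rw [← Real.exp_add]
    refine Real.exp_lt_exp.2 ?_
    linarith

end

theorem proposition5p7 (p : ℝ) (hp : 1 < p) :
    ∃ a b : ℝ, 0 < a ∧ 0 < b ∧
      IsYoung (oscPhi a b) ∧ SatisfiesDelta2 (oscPhi a b) ∧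
      IsRINorm lebesgueNN (olNorm p (oscPhi a b)) ∧
      IsPHomogeneous p (olNorm p (oscPhi a b)) ∧
      ∀ q : ℝ, 3 < q → q < 5 →
        ¬ lorentzSpace p q ⊆ olSpace p (oscPhi a b) ∧
        ¬ olSpace p (oscPhi a b) ⊆ lorentzSpace p q :=
  ⟨oscA, oscB, oscA_pos, by unfold oscB; positivity, isYoung_oscPhi, satisfiesDelta2_oscPhi,
    isRINorm_olNorm hp isYoung_oscPhi, isPHomogeneous_olNorm isYoung_oscPhi,
    fun q hq3 hq5 => ⟨not_lorentzSpace_subset_olSpace_oscPhi hp hq3,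
      not_olSpace_oscPhi_subset_lorentzSpace hp (by linarith) hq5⟩⟩
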